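/- **Conventions.** Manifolds are smooth, Hausdorff, second countable and finite dimensional. A *dually flat manifold* $(M,h,\nabla)$ is a manifold with a Riemannian metric $h$ and a linear connection $\nabla$ such that $\nabla$ and its dual connection $\nabla^*$, defined by $X\,h(Y,Z)=h(\nabla_XY,Z)+h(Y,\nabla^*_XZ)$, are both flat (zero torsion and zero curvature). If $K$ is the connector of $\nabla$ and $\pi:TM\to M$ the projection, identify $T_u(TM)\cong T_pM\oplus T_pM$ by $A\mapsto(\pi_*A,KA)$; then $TM$ is a Kähler manifold with $g((v,w),(v',w'))=h(v,v')+h(w,w')$ and $J(v,w)=(-w,v)$. A smooth map between dually flat manifolds is *affine* if around every point it is given, in suitable affine coordinate systems, by the restriction of an affine map. A *Kähler immersion* is a holomorphic and isometric immersion. Put $\mathbb{T}^n=\mathbb{R}^n/\mathbb{Z}^n$. Let $(M,h,\nabla)$ be a connected dually flat manifold of dimension $n$, and let $N$ be a connected Kähler manifold of complex dimension $n$ with an effective, holomorphic and isometric smooth action $\Phi:\mathbb{T}^n\times N\to N$. Let $N^\circ\subseteq N$ be the set of points at which the action is free. A *toric parametrization* $(L,X,F)$ consists of a global frame $X=(X_1,\dots,X_n)$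 of $\nabla$-parallel vector fields on $M$, the lattice $L\subset TM$ of all their integral combinations, and a holomorphic and isometric diffeomorphism $F:M_L\to N^\circ$, where $M_L$ is the quotient of $TM$ by the group of translations $u\mapsto u+k_1X_1+\dots+k_nX_n$ $(k_i\in\mathbb{Z})$ with quotient map $q_L:TM\to M_L$ and the induced Kähler structure, such that $F(q_L(u+t_1X_1+\dots+t_nX_n))=\Phi([t],F(q_L(u)))$ for all $t\in\mathbb{R}^n$, $u\in TM$. If a toric parametrization exists, $\Phi$ is a *torification* of $M$, and the maps $\tau=F\circ q_L:TM\to N^\circ$ arising in this way are the *compatible covering maps*. **Statement.** Let $\Phi:\mathbb{T}^n\times N\to N$ and $\Phi':\mathbb{T}^d\times N'\to N'$ be torifications of the connected dually flat manifolds $(M,h,\nabla)$ and $(M',h',\nabla')$ of dimensions $n$ and $d$. Let $f:M\to M'$ and $m:N\to N'$ be smooth maps such that $m$ is a *lift* of $f$, that is, $m\circ\tau=\tau'\circ f_*$ for some compatible covering maps $\tau:TM\to N^\circ$ and $\tau':TM'\to(N')^\circ$. 1. $m$ is a Kähler immersion if and only if $f$ is an isometric affine immersion. 2. If $f$ is an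 isometric affine immersion, then there exists a unique Lie group homomorphism $\rho:\mathbb{T}^n\to\mathbb{T}^d$ such that $m\circ\Phi_a=\Phi'_{\rho(a)}\circ m$ for all $a\in\mathbb{T}^n$, and the kernel of $\rho$ is finite. -/

import Mathlib

open scoped Manifold ContDiff Topology Bundle

noncomputable section

namespace Torif

/-! ### Vector fields, flat connections, dually flat manifolds -/

/-- The model space of an `n`-dimensional real manifold. -/
abbrev RModel (n : ℕ) : Type := EuclideanSpace ℝ (Fin n)

/-- The model space of an `n`-dimensional complex manifold. -/
abbrev CModel (n : ℕ) : Type := EuclideanSpace ℂ (Fin n)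

section Real

variable {n : ℕ} {M : Type*} [TopologicalSpace M] [ChartedSpace (RModel n) M]
  [IsManifold (𝓡 n) ∞ M]

/-- Smooth vector fields on a real manifold. -/
def IsSmoothField (X : Π p : M, TangentSpace (𝓡 n) p) : Prop :=
  ContMDiff (𝓡 n) (𝓡 n).tangent ∞ (fun p => (⟨p, X p⟩ : TangentBundle (𝓡 n) M))

/-- Riemannian metrics on a real manifold. -/
abbrev RMetric (n : ℕ) (M : Type*) [TopologicalSpace M] [ChartedSpace (RModel n) M]
    [IsManifold (𝓡 n) ∞ M] :=
  Bundle.ContMDiffRiemannianMetric (𝓡 n) ∞ (RModel n) (TangentSpace (𝓡 n) : M → Type _)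

/-- Linear connections; `cov Y p v` is `(∇_v Y)(p)`. -/
abbrev Conn (n : ℕ) (M : Type*) [TopologicalSpace M] [ChartedSpace (RModel n) M]
    [IsManifold (𝓡 n) ∞ M] :=
  CovariantDerivative (𝓡 n) (RModel n) (TangentSpace (𝓡 n) : M → Type _)

/-- The curvature `R(X,Y)Z = ∇_X ∇_Y Z - ∇_Y ∇_X Z - ∇_{[X,Y]} Z`. -/
def curvature (cov : Conn n M) (X Y Z : Π p : M, TangentSpace (𝓡 n) p) (p : M) :
    TangentSpace (𝓡 n) p :=
  cov (fun q => cov Z q (Y q)) p (X p) - cov (fun q => cov Z q (X q)) p (Y p)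
    - cov Z p (VectorField.mlieBracket (𝓡 n) X Y p)

/-- A smooth connection is flat if its torsion and its curvature vanish. -/
structure IsFlat (cov : Conn n M) : Prop where
  smooth : CovariantDerivative.ContMDiffCovariantDerivative cov ∞
  torsion_eq_zero : ∀ p, cov.torsion p = 0
  curvature_eq_zero : ∀ X Y Z : Π p : M, TangentSpace (𝓡 n) p,
    IsSmoothField X → IsSmoothField Y → IsSmoothField Z → ∀ p, curvature cov X Y Z p = 0

/-- `cov'` is dual to `cov` with respect to `h`:
`X h(Y,Z) = h(∇_X Y, Z) + h(Y, ∇*_X Z)`. -/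
def IsDual (h : RMetric n M) (cov cov' : Conn n M) : Prop :=
  ∀ X Y Z : Π p : M, TangentSpace (𝓡 n) p,
    IsSmoothField X → IsSmoothField Y → IsSmoothField Z → ∀ p,
      (mfderiv (𝓡 n) 𝓘(ℝ, ℝ) (fun q => h.inner q (Y q) (Z q)) p (X p) : ℝ)
        = h.inner p (cov Y p (X p)) (Z p) + h.inner p (Y p) (cov' Z p (X p))

end Real

/-- A dually flat structure on `M`: a metric, a flat connection, and its dual connection (which is
determined by the other two), also flat. -/
structure DuallyFlat (n : ℕ) (M : Type*) [TopologicalSpace M] [ChartedSpace (RModel n) M]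
    [IsManifold (𝓡 n) ∞ M] where
  metric : RMetric n M
  conn : Conn n M
  dualConn : Conn n M
  dual : IsDual metric conn dualConn
  flat : IsFlat conn
  dualFlat : IsFlat dualConn

section Affine

variable {n d : ℕ}
  {M : Type*} [TopologicalSpace M] [ChartedSpace (RModel n) M] [IsManifold (𝓡 n) ∞ M]
  {M' : Type*} [TopologicalSpace M'] [ChartedSpace (RModel d) M'] [IsManifold (𝓡 d) ∞ M']

/-- The vector field on the domain of a chart `e` with constant coefficients `v` in that chart. -/
def coordField (e : OpenPartialHomeomorph M (RModel n)) (v : RModel n) :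
    Π p : M, TangentSpace (𝓡 n) p :=
  fun p => (mfderiv (𝓡 n) (𝓡 n) e p).inverse v

/-- Affine coordinate systems: smooth charts whose coordinate vector fields satisfy
`∇_{∂_i} ∂_j = 0`. -/
def IsAffineChart (cov : Conn n M) (e : OpenPartialHomeomorph M (RModel n)) : Prop :=
  e ∈ IsManifold.maximalAtlas (𝓡 n) ∞ M ∧
    ∀ v w : RModel n, ∀ p ∈ e.source, cov (coordField e w) p (coordField e v p) = 0

/-- A map is affine if around every point it is the restriction of an affine map in suitable affine
coordinates. -/
def IsAffineMap (cov : Conn n M) (cov' : Conn d M') (f : M → M') : Prop :=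
  ∀ p : M, ∃ (e : OpenPartialHomeomorph M (RModel n)) (e' : OpenPartialHomeomorph M' (RModel d)),
    IsAffineChart cov e ∧ IsAffineChart cov' e' ∧ p ∈ e.source ∧ f '' e.source ⊆ e'.source ∧
      ∃ A : RModel n →ᵃ[ℝ] RModel d, ∀ y ∈ e.target, e' (f (e.symm y)) = A y

/-- Isometric affine immersions between dually flat manifolds. -/
structure IsIsometricAffineImmersion (S : DuallyFlat n M) (S' : DuallyFlat d M') (f : M → M') :
    Prop where
  smooth : ContMDiff (𝓡 n) (𝓡 d) ∞ f
  immersion : ∀ p, Function.Injective (mfderiv (𝓡 n) (𝓡 d) f p)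
  isometric : ∀ (p : M) (v w : TangentSpace (𝓡 n) p),
    S'.metric.inner (f p) (mfderiv (𝓡 n) (𝓡 d) f p v) (mfderiv (𝓡 n) (𝓡 d) f p w)
      = S.metric.inner p v w
  affine : IsAffineMap S.conn S'.conn f

end Affine

/-! ### Dombrowski's construction on the tangent bundle -/

section Dombrowski

variable {n : ℕ} {M : Type*} [TopologicalSpace M] [ChartedSpace (RModel n) M]
  [IsManifold (𝓡 n) ∞ M]

/-- The differential `π_* : T_u(TM) → T_p M` of the projection. -/
def projDeriv (u : TangentBundle (𝓡 n) M) (A : TangentSpace (𝓡 n).tangent u) :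
    TangentSpace (𝓡 n) u.proj :=
  mfderiv (𝓡 n).tangent (𝓡 n) (Bundle.TotalSpace.proj : TangentBundle (𝓡 n) M → M) u A

/-- The Christoffel term `v ↦ ∑ Γ_{ij}^k(p) v_i u_j ∂_k` at `u ∈ T_p M`, in the preferred chart
at `p`: the covariant derivative of the vector field which extends `u` with constant coefficients
in that chart. -/
def christoffel (cov : Conn n M) (u : TangentBundle (𝓡 n) M) :
    TangentSpace (𝓡 n) u.proj →L[ℝ] TangentSpace (𝓡 n) u.proj :=
  cov (FiberBundle.extend (RModel n) u.2) u.proj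

/-- The fibre component `(q̇, ṙ) ↦ ṙ` of a vector tangent to `TM` at `u`, in the coordinates `(q, r)`
of `TM` induced by the preferred chart at the base point of `u`. -/
def fibreCoord (u : TangentBundle (𝓡 n) M) (A : TangentSpace (𝓡 n).tangent u) :
    TangentSpace (𝓡 n) u.proj :=
  (show RModel n × RModel n from A).2

/-- The vector tangent to `TM` at `u` with components `(a, b)` in the coordinates `(q, r)`. -/
def ofCoord (u : TangentBundle (𝓡 n) M) (a b : TangentSpace (𝓡 n) u.proj) :
    TangentSpace (𝓡 n).tangent u :=
  (show RModel n × RModel n from (a, b))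

/-- The connector `K_u : T_u(TM) → T_p M`. -/
def connector (cov : Conn n M) (u : TangentBundle (𝓡 n) M) (A : TangentSpace (𝓡 n).tangent u) :
    TangentSpace (𝓡 n) u.proj :=
  fibreCoord u A + christoffel cov u (projDeriv u A)

/-- Under `A ↦ (π_* A, K A)`, the metric on `TM` is `g((v,w),(v',w')) = h(v,v') + h(w,w')`. -/
def tangentMetric (S : DuallyFlat n M) (u : TangentBundle (𝓡 n) M)
    (A B : TangentSpace (𝓡 n).tangent u) : ℝ :=
  S.metric.inner u.proj (projDeriv u A) (projDeriv u B)
    + S.metric.inner u.proj (connector S.conn u A) (connector S.conn u B)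

/-- Under `A ↦ (π_* A, K A)`, the complex structure on `TM` is `J(v,w) = (-w,v)`; see
`projDeriv_tangentJ` and `connector_tangentJ`. -/
def tangentJ (cov : Conn n M) (u : TangentBundle (𝓡 n) M) (A : TangentSpace (𝓡 n).tangent u) :
    TangentSpace (𝓡 n).tangent u :=
  ofCoord u (-connector cov u A) (projDeriv u A + christoffel cov u (connector cov u A))

theorem projDeriv_ofCoord (u : TangentBundle (𝓡 n) M) (a b : TangentSpace (𝓡 n) u.proj) :
    projDeriv u (ofCoord u a b) = a := by
  have hd : HasMFDerivAt (𝓡 n).tangent (𝓡 n)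
      (Bundle.TotalSpace.proj : TangentBundle (𝓡 n) M → M) u
      (ContinuousLinearMap.fst ℝ (RModel n) (RModel n)) := by
    refine ⟨(Bundle.contMDiff_proj (n := ∞) (IB := 𝓡 n)
      (TangentSpace (𝓡 n) : M → Type _)).continuous.continuousAt, ?_⟩
    have key : ∀ y ∈ (chartAt (ModelProd (RModel n) (RModel n)) u).target,
        chartAt (RModel n) u.proj ((chartAt (RModel n) u.proj).symm y.1) = y.1 := fun y hy =>
      (chartAt (RModel n) u.proj).right_inv ((TangentBundle.mem_chart_target_iff y u).1 hy)
    refine (ContinuousLinearMap.hasFDerivWithinAt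
      (ContinuousLinearMap.fst ℝ (RModel n) (RModel n))).congr_of_eventuallyEq ?_ ?_
    · filter_upwards [extChartAt_target_mem_nhdsWithin (I := (𝓡 n).tangent) u] with y hy
      simp only [writtenInExtChartAt, mfld_simps] at hy ⊢
      exact key y hy
    · simp only [writtenInExtChartAt, mfld_simps]
      exact key _ (mem_chart_target _ u)
  unfold projDeriv
  rw [hd.mfderiv]
  rfl

theorem projDeriv_tangentJ (cov : Conn n M) (u : TangentBundle (𝓡 n) M)
    (A : TangentSpace (𝓡 n).tangent u) :
    projDeriv u (tangentJ cov u A) = -connector cov u A :=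
  projDeriv_ofCoord u _ _

theorem connector_tangentJ (cov : Conn n M) (u : TangentBundle (𝓡 n) M)
    (A : TangentSpace (𝓡 n).tangent u) :
    connector cov u (tangentJ cov u A) = projDeriv u A := by
  have h : fibreCoord u (tangentJ cov u A)
      = projDeriv u A + christoffel cov u (connector cov u A) := rfl
  rw [connector, projDeriv_tangentJ, h, map_neg]
  abel

end Dombrowski

/-! ### Kähler manifolds -/

section Kahler

/-- A complex manifold is a real smooth manifold. -/
instance isManifold_real (n : ℕ) (N : Type*) [TopologicalSpace N] [ChartedSpace (CModel n) N]
    [IsManifold 𝓘(ℂ, CModel n) ω N] : IsManifold 𝓘(ℝ, CModel n) ∞ N := by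
  apply isManifold_of_contDiffOn
  intro e e' he he'
  have h := (contDiffGroupoid ω 𝓘(ℂ, CModel n)).compatible he he'
  rw [contDiffGroupoid, mem_groupoid_of_pregroupoid] at h
  exact (h.1.restrict_scalars ℝ).of_le le_top

variable {n : ℕ} {N : Type*} [TopologicalSpace N] [ChartedSpace (CModel n) N]
  [IsManifold 𝓘(ℂ, CModel n) ω N]

/-- Smooth vector fields on a complex manifold. -/
def IsSmoothCField (X : Π p : N, TangentSpace 𝓘(ℝ, CModel n) p) : Prop :=
  ContMDiff 𝓘(ℝ, CModel n) 𝓘(ℝ, CModel n).tangent ∞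
    (fun p => (⟨p, X p⟩ : TangentBundle 𝓘(ℝ, CModel n) N))

/-- The complex structure on the tangent spaces of a complex manifold: multiplication by `i` in
the preferred holomorphic chart. -/
def complexJ {n : ℕ} {N : Type*} [TopologicalSpace N] [ChartedSpace (CModel n) N] (p : N) :
    TangentSpace 𝓘(ℝ, CModel n) p →L[ℝ] TangentSpace 𝓘(ℝ, CModel n) p :=
  show CModel n →L[ℝ] CModel n from
    (Complex.I • ContinuousLinearMap.id ℂ (CModel n)).restrictScalars ℝ

/-- A Kähler structure on a complex manifold: a Hermitian metric `g` such that the 2-form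
`ω(u,v) = g(Ju,v)` is closed. -/
structure Kahler (n : ℕ) (N : Type*) [TopologicalSpace N] [ChartedSpace (CModel n) N]
    [IsManifold 𝓘(ℂ, CModel n) ω N] where
  metric : Bundle.ContMDiffRiemannianMetric 𝓘(ℝ, CModel n) ∞ (CModel n)
    (TangentSpace 𝓘(ℝ, CModel n) : N → Type _)
  hermitian : ∀ (p : N) (v w : TangentSpace 𝓘(ℝ, CModel n) p),
    metric.inner p (complexJ p v) (complexJ p w) = metric.inner p v w
  closed : ∀ X Y Z : Π p : N, TangentSpace 𝓘(ℝ, CModel n) p,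
    IsSmoothCField X → IsSmoothCField Y → IsSmoothCField Z → ∀ p : N,
      letI form (q : N) (v w : TangentSpace 𝓘(ℝ, CModel n) q) : ℝ :=
        metric.inner q (complexJ q v) w
      letI D (φ : N → ℝ) (v : TangentSpace 𝓘(ℝ, CModel n) p) : ℝ :=
        mfderiv 𝓘(ℝ, CModel n) 𝓘(ℝ, ℝ) φ p v
      letI br (V W : Π p : N, TangentSpace 𝓘(ℝ, CModel n) p) :=
        VectorField.mlieBracket 𝓘(ℝ, CModel n) V W p
      D (fun q => form q (Y q) (Z q)) (X p) - D (fun q => form q (X q) (Z q)) (Y p)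
        + D (fun q => form q (X q) (Y q)) (Z p)
        - form p (br X Y) (Z p) + form p (br X Z) (Y p) - form p (br Y Z) (X p) = 0

variable {d : ℕ} {N' : Type*} [TopologicalSpace N'] [ChartedSpace (CModel d) N']
  [IsManifold 𝓘(ℂ, CModel d) ω N']

/-- A smooth map of complex manifolds is holomorphic if its differential commutes with the complex
structures. -/
def IsHolomorphic (n d : ℕ) {N N' : Type*} [TopologicalSpace N] [ChartedSpace (CModel n) N]
    [TopologicalSpace N'] [ChartedSpace (CModel d) N'] (m : N → N') : Prop :=
  ∀ (p : N) (v : TangentSpace 𝓘(ℝ, CModel n) p),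
    mfderiv 𝓘(ℝ, CModel n) 𝓘(ℝ, CModel d) m p (complexJ p v)
      = complexJ (m p) (mfderiv 𝓘(ℝ, CModel n) 𝓘(ℝ, CModel d) m p v)

/-- A smooth map of Kähler manifolds is isometric if it pulls back the metric to the metric. -/
def IsIsometric (G : Kahler n N) (G' : Kahler d N') (m : N → N') : Prop :=
  ∀ (p : N) (v w : TangentSpace 𝓘(ℝ, CModel n) p),
    G'.metric.inner (m p) (mfderiv 𝓘(ℝ, CModel n) 𝓘(ℝ, CModel d) m p v)
        (mfderiv 𝓘(ℝ, CModel n) 𝓘(ℝ, CModel d) m p w)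
      = G.metric.inner p v w

/-- Kähler immersions: holomorphic and isometric immersions. -/
structure IsKahlerImmersion (G : Kahler n N) (G' : Kahler d N') (m : N → N') : Prop where
  smooth : ContMDiff 𝓘(ℝ, CModel n) 𝓘(ℝ, CModel d) ∞ m
  immersion : ∀ p, Function.Injective (mfderiv 𝓘(ℝ, CModel n) 𝓘(ℝ, CModel d) m p)
  holomorphic : IsHolomorphic n d m
  isometric : IsIsometric G G' m

end Kahler

/-! ### Tori and torus actions -/

/-- The torus `ℝⁿ/ℤⁿ`. -/
abbrev Torus (n : ℕ) : Type := Fin n → UnitAddCircle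

/-- The projection `t ↦ [t]` from `ℝⁿ` to the torus. -/
def Torus.mk {n : ℕ} (t : Fin n → ℝ) : Torus n := fun i => (t i : UnitAddCircle)

/-- Lie group homomorphisms of tori, i.e. smooth group homomorphisms. The smooth structure of
the torus is the one for which `ℝⁿ → 𝕋ⁿ` is a local diffeomorphism and `ℝ/ℤ ≃ S¹` a
diffeomorphism. -/
structure IsLieHom {n d : ℕ} (ρ : Torus n →+ Torus d) : Prop where
  smooth : ∀ j : Fin d, ContMDiff 𝓘(ℝ, Fin n → ℝ) (𝓡 1) ∞
    (fun t : Fin n → ℝ => (ρ (Torus.mk t) j).toCircle)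

/-- Effective, holomorphic and isometric smooth actions of the torus on a Kähler manifold.
Smoothness on `𝕋ⁿ × N` is tested on the cover `ℝⁿ × N`. -/
structure TorusAction {n : ℕ} {N : Type*} [TopologicalSpace N] [ChartedSpace (CModel n) N]
    [IsManifold 𝓘(ℂ, CModel n) ω N] (G : Kahler n N) where
  act : Torus n → N → N
  act_zero : ∀ p, act 0 p = p
  act_add : ∀ a b p, act (a + b) p = act a (act b p)
  smooth : ContMDiff (𝓘(ℝ, Fin n → ℝ).prod 𝓘(ℝ, CModel n)) 𝓘(ℝ, CModel n) ∞
    (fun x : (Fin n → ℝ) × N => act (Torus.mk x.1) x.2)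
  effective : ∀ a, (∀ p, act a p = p) → a = 0
  holomorphic : ∀ a, IsHolomorphic n n (act a)
  isometric : ∀ a, IsIsometric G G (act a)

/-- The set `N°` of points where the action is free. -/
def TorusAction.free {n : ℕ} {N : Type*} [TopologicalSpace N] [ChartedSpace (CModel n) N]
    [IsManifold 𝓘(ℂ, CModel n) ω N] {G : Kahler n N} (Φ : TorusAction G) : Set N :=
  {p | ∀ a, Φ.act a p = p → a = 0}

/-! ### Parallel lattices, torifications and lifts -/

section Torification

variable {n : ℕ} {M : Type*} [TopologicalSpace M] [ChartedSpace (RModel n) M]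
  [IsManifold (𝓡 n) ∞ M]

/-- `X` is a generator of the parallel lattice `L ⊆ TM`: a global frame of parallel vector fields
whose integral combinations form `L`. -/
structure IsGenerator (cov : Conn n M) (L : Set (TangentBundle (𝓡 n) M))
    (X : Fin n → Π p : M, TangentSpace (𝓡 n) p) : Prop where
  smooth : ∀ i, IsSmoothField (X i)
  parallel : ∀ i p, cov (X i) p = 0
  linearIndependent : ∀ p, LinearIndependent ℝ (fun i => X i p)
  span_eq_top : ∀ p, Submodule.span ℝ (Set.range (fun i => X i p)) = ⊤
  lattice : L = {u | ∃ (p : M) (k : Fin n → ℤ), u = ⟨p, ∑ i, (k i : ℝ) • X i p⟩}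

/-- The translation `u ↦ u + t₁ X₁ + ⋯ + tₙ Xₙ` of `TM`. -/
def translate (X : Fin n → Π p : M, TangentSpace (𝓡 n) p) (t : Fin n → ℝ)
    (u : TangentBundle (𝓡 n) M) : TangentBundle (𝓡 n) M :=
  ⟨u.proj, u.2 + ∑ i, t i • X i u.proj⟩

/-- The orbit relation of the group `Γ(L)` of translations by integral combinations of `X`. -/
def orbitSetoid (X : Fin n → Π p : M, TangentSpace (𝓡 n) p) :
    Setoid (TangentBundle (𝓡 n) M) where
  r u v := ∃ k : Fin n → ℤ, v = translate X (fun i => (k i : ℝ)) u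
  iseqv :=
    { refl := fun u => ⟨0, congrArg (Bundle.TotalSpace.mk u.proj) (by simp)⟩
      symm := by
        rintro u v ⟨k, rfl⟩
        refine ⟨-k, congrArg (Bundle.TotalSpace.mk u.proj) ?_⟩
        have h : ∀ v w : TangentSpace (𝓡 n) u.proj, w = w + v + -v := fun v w => by abel
        refine (h (∑ i, (k i : ℝ) • X i u.proj) u.2).trans ?_
        refine congrArg (fun z => u.2 + ∑ i, (k i : ℝ) • X i u.proj + z) ?_
        have h' : ∀ t : Fin n → ℝ, -∑ i, t i • X i u.proj = ∑ i, (-t i) • X i u.proj :=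
          fun t => by simp
        refine (h' fun i => (k i : ℝ)).trans (Finset.sum_congr rfl fun i _ => ?_)
        exact congrArg (fun c : ℝ => c • X i u.proj) (by simp)
      trans := by
        rintro u v w ⟨k, rfl⟩ ⟨l, rfl⟩
        refine ⟨k + l, congrArg (Bundle.TotalSpace.mk u.proj) ?_⟩
        have h : ∀ v w z : TangentSpace (𝓡 n) u.proj, v + w + z = v + (w + z) := add_assoc
        refine (h u.2 (∑ i, (k i : ℝ) • X i u.proj) (∑ i, (l i : ℝ) • X i u.proj)).trans ?_
        simp [add_smul, Finset.sum_add_distrib] }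

/-- The quotient `M_L = TM / Γ(L)`, for the parallel lattice `L` generated by `X`. -/
abbrev LatticeQuotient (X : Fin n → Π p : M, TangentSpace (𝓡 n) p) : Type _ :=
  Quotient (orbitSetoid X)

/-- The quotient map `q_L : TM → M_L`. -/
def quotientMap (X : Fin n → Π p : M, TangentSpace (𝓡 n) p) (u : TangentBundle (𝓡 n) M) :
    LatticeQuotient X :=
  Quotient.mk (orbitSetoid X) u

variable {N : Type*} [TopologicalSpace N] [ChartedSpace (CModel n) N]
  [IsManifold 𝓘(ℂ, CModel n) ω N] {G : Kahler n N}

/-- A toric parametrization `(L, X, F)`: a parallel lattice `L`, a generator `X` of `L`, and an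
equivariant holomorphic and isometric diffeomorphism `F : M_L → N°`. The Kähler manifold
structure of `M_L` is the one for which the covering map `q_L : TM → M_L` is a holomorphic and
isometric local diffeomorphism, so that `F` is a holomorphic and isometric diffeomorphism
if and only if it is a homeomorphism and `F ∘ q_L` is a holomorphic and isometric local
diffeomorphism. The torus acts on `M_L` by `[t] · q_L(u) = q_L(u + t₁ X₁ + ⋯ + tₙ Xₙ)`. -/
structure ToricParametrization (S : DuallyFlat n M) (Φ : TorusAction G) where
  L : Set (TangentBundle (𝓡 n) M)
  X : Fin n → Π p : M, TangentSpace (𝓡 n) p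
  isGenerator : IsGenerator S.conn L X
  F : LatticeQuotient X ≃ₜ Φ.free
  isLocalDiffeomorph : IsLocalDiffeomorph (𝓡 n).tangent 𝓘(ℝ, CModel n) ∞
    (fun u => (F (quotientMap X u) : N))
  holomorphic : ∀ (u : TangentBundle (𝓡 n) M) (A : TangentSpace (𝓡 n).tangent u),
    mfderiv (𝓡 n).tangent 𝓘(ℝ, CModel n) (fun u => (F (quotientMap X u) : N)) u
        (tangentJ S.conn u A)
      = complexJ _ (mfderiv (𝓡 n).tangent 𝓘(ℝ, CModel n) (fun u => (F (quotientMap X u) : N)) u A)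
  isometric : ∀ (u : TangentBundle (𝓡 n) M) (A B : TangentSpace (𝓡 n).tangent u),
    G.metric.inner _
        (mfderiv (𝓡 n).tangent 𝓘(ℝ, CModel n) (fun u => (F (quotientMap X u) : N)) u A)
        (mfderiv (𝓡 n).tangent 𝓘(ℝ, CModel n) (fun u => (F (quotientMap X u) : N)) u B)
      = tangentMetric S u A B
  equivariant : ∀ (t : Fin n → ℝ) (u : TangentBundle (𝓡 n) M),
    (F (quotientMap X (translate X t u)) : N) = Φ.act (Torus.mk t) (F (quotientMap X u))

/-- `Φ` is a torification of the dually flat manifold. -/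
def IsTorification (S : DuallyFlat n M) (Φ : TorusAction G) : Prop :=
  Nonempty (ToricParametrization S Φ)

/-- Compatible covering maps `τ : TM → N°`, i.e. `τ = F ∘ q_L` for a toric parametrization
`(L, X, F)`. -/
def IsCompatibleCovering (S : DuallyFlat n M) (Φ : TorusAction G)
    (τ : TangentBundle (𝓡 n) M → Φ.free) : Prop :=
  ∃ P : ToricParametrization S Φ, ∀ u, τ u = P.F (quotientMap P.X u)

variable {d : ℕ} {M' : Type*} [TopologicalSpace M'] [ChartedSpace (RModel d) M']
  [IsManifold (𝓡 d) ∞ M'] {N' : Type*} [TopologicalSpace N'] [ChartedSpace (CModel d) N']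
  [IsManifold 𝓘(ℂ, CModel d) ω N'] {G' : Kahler d N'}

/-- The smooth map `m : N → N'` is a lift of the smooth map `f : M → M'`: there are compatible
covering maps `τ`, `τ'` with `m ∘ τ = τ' ∘ f_*`. -/
structure IsLift (S : DuallyFlat n M) (Φ : TorusAction G) (S' : DuallyFlat d M')
    (Φ' : TorusAction G') (f : M → M') (m : N → N') : Prop where
  smooth_base : ContMDiff (𝓡 n) (𝓡 d) ∞ f
  smooth : ContMDiff 𝓘(ℝ, CModel n) 𝓘(ℝ, CModel d) ∞ m
  exists_covering : ∃ (τ : TangentBundle (𝓡 n) M → Φ.free) (τ' : TangentBundle (𝓡 d) M' → Φ'.free),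
    IsCompatibleCovering S Φ τ ∧ IsCompatibleCovering S' Φ' τ' ∧
      ∀ u, m (τ u) = τ' (tangentMap (𝓡 n) (𝓡 d) f u)

end Torification

end Torif

end

/-
A parallel frame `X` of `M` defines `θ : TM → ℝⁿ`, the coordinates in `X`, whose differential is
`coframe X ∘ K`, where `K` is the connector. Hence `f_*` is holomorphic (i.e. `f_**` commutes with
`J`, equivalently with the connectors) iff `θ' ∘ f_*` is locally, hence globally, a constant matrix
`a` applied to `θ`; flatness provides charts in which the coordinate fields are the `Xᵢ`, and
integrating there shows that this happens iff `f` is affine.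

The covering maps `τ`, `τ'` are holomorphic isometric local diffeomorphisms onto the free loci, so
`m` is holomorphic (isometric) on `N°` iff `f_*` is. A nontrivial closed subgroup of a torus
contains a nontrivial element of finite order, there are countably many of these, and each has a
fixed point set with empty interior by the identity theorem; so `N°` is dense by Baire's theorem,
and both properties extend to `N`.

Finally `f_*` intertwines translation by `t` with translation by `a t`. Translations by
lattice vectors fix `τ u`, and only the neutral element of `𝕋ᵈ` fixes `m (τ u) ∈ N'°`, so `a` is
integral and induces `ρ`; it is injective when `f` is an immersion, and then `ker ρ` is finite.
-/

noncomputable section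

namespace Torif

section Calculus

open ContinuousLinearMap in
theorem fderiv_inverse_symm {E F : Type*} [NormedAddCommGroup E] [NormedSpace ℝ E]
    [NormedAddCommGroup F] [NormedSpace ℝ F] [CompleteSpace F] {T : E → F →L[ℝ] E} {y : E}
    (hT : DifferentiableAt ℝ T y) (hinv : (T y).IsInvertible)
    (hbr : ∀ b c, VectorField.lieBracket ℝ (fun z => T z b) (fun z => T z c) y = 0) (v w : E) :
    fderiv ℝ (fun z => (T z).inverse) y v w = fderiv ℝ (fun z => (T z).inverse) y w v := by
  have hS : DifferentiableAt ℝ (fun z => (T z).inverse) y :=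
    (hinv.contDiffAt_map_inverse (n := 1)).differentiableAt one_ne_zero |>.comp y hT
  have hcomp : (fun z => (T z).inverse ∘L T z) =ᶠ[𝓝 y] fun _ => .id ℝ F := by
    obtain ⟨e, he⟩ := hinv
    filter_upwards [hT.continuousAt.preimage_mem_nhds (he ▸ e.nhds)] with z ⟨e', he'⟩
    exact IsInvertible.inverse_comp_self ⟨e', he'⟩
  have hderiv (b c : F) : fderiv ℝ (fun z => (T z).inverse) y (T y b) (T y c)
      = -(T y).inverse (fderiv ℝ T y (T y b) c) := by
    have h := (fderiv_clm_comp hS hT).symm.trans (hcomp.fderiv_eq.trans (fderiv_const_apply _))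
    have hbc := congrArg (fun S => S (T y b) c) h
    rw [eq_neg_iff_add_eq_zero, add_comm]
    exact hbc
  have hsymm (b c : F) : fderiv ℝ T y (T y b) c = fderiv ℝ T y (T y c) b := by
    have hap (a : F) : fderiv ℝ (fun z => T z a) y = (fderiv ℝ T y).flip a := by
      rw [fderiv_clm_apply hT (differentiableAt_const a), fderiv_const_apply, comp_zero, zero_add]
    have h := hbr b c
    rw [VectorField.lieBracket, hap, hap] at h
    exact sub_eq_zero.1 h
  obtain ⟨b, rfl⟩ := hinv.surjective v
  obtain ⟨c, rfl⟩ := hinv.surjective w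
  rw [hderiv, hderiv, hsymm]

theorem exists_openPartialHomeomorph_of_isInvertible_fderiv {E F : Type*} [NormedAddCommGroup E]
    [NormedSpace ℝ E] [CompleteSpace E] [NormedAddCommGroup F] [NormedSpace ℝ F] {x : E → F}
    {B : Set E} (hB : IsOpen B) (hx : ContDiffOn ℝ ∞ x B)
    (hinv : ∀ y ∈ B, (fderiv ℝ x y).IsInvertible) {y₀ : E} (hy₀ : y₀ ∈ B) :
    ∃ g : OpenPartialHomeomorph E F, ⇑g = x ∧ y₀ ∈ g.source ∧ g.source ⊆ B ∧
      ContDiffOn ℝ ∞ g.symm g.target := by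
  have hxAt (y) (hy : y ∈ B) : ContDiffAt ℝ ∞ x y := hx.contDiffAt (hB.mem_nhds hy)
  have hequiv (y) (hy : y ∈ B) : ∃ e : E ≃L[ℝ] F, HasFDerivAt x (e : E →L[ℝ] F) y := by
    obtain ⟨e, he⟩ := hinv y hy
    exact ⟨e, he ▸ ((hxAt y hy).differentiableAt (by simp)).hasFDerivAt⟩
  obtain ⟨e, he⟩ := hequiv y₀ hy₀
  let g := ((hxAt y₀ hy₀).toOpenPartialHomeomorph x he (by simp)).restrOpen B hB
  refine ⟨g, rfl, ⟨(hxAt y₀ hy₀).mem_toOpenPartialHomeomorph_source he (by simp), hy₀⟩,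
    fun y hy => hy.2, fun z hz => ?_⟩
  have hzB : g.symm z ∈ B := (g.map_target hz).2
  obtain ⟨e', he'⟩ := hequiv _ hzB
  exact (g.contDiffAt_symm hz he' (hxAt _ hzB)).contDiffWithinAt

end Calculus

section Manifold

variable {E : Type*} [NormedAddCommGroup E] [NormedSpace ℝ E] {H : Type*} [TopologicalSpace H]
  {I : ModelWithCorners ℝ E H} {M : Type*} [TopologicalSpace M] [ChartedSpace H M]

theorem hasMFDerivAt_clm_apply {V W : Type*} [NormedAddCommGroup V] [NormedSpace ℝ V]
    [NormedAddCommGroup W] [NormedSpace ℝ W] {T : M → V →L[ℝ] W} {r : M → V} {x : M}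
    {T' : E →L[ℝ] V →L[ℝ] W} {r' : E →L[ℝ] V} (hT : HasMFDerivAt I 𝓘(ℝ, V →L[ℝ] W) T x T')
    (hr : HasMFDerivAt I 𝓘(ℝ, V) r x r') :
    HasMFDerivAt I 𝓘(ℝ, W) (fun y => T y (r y)) x (T x ∘L r' + T'.flip (r x)) := by
  refine ⟨hT.1.clm_apply hr.1, ?_⟩
  have h := HasFDerivWithinAt.clm_apply hT.2 hr.2
  simp only [writtenInExtChartAt, mfld_simps] at h ⊢
  exact h

theorem mlieBracket_eq_lieBracket (V W : Π x : E, TangentSpace 𝓘(ℝ, E) x) :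
    VectorField.mlieBracket 𝓘(ℝ, E) V W = VectorField.lieBracket ℝ V W := by
  rw [← VectorField.mlieBracketWithin_univ, VectorField.mlieBracketWithin_eq_lieBracketWithin]
  exact VectorField.lieBracketWithin_univ

theorem eventually_eq_of_mfderiv_eq_zero [I.Boundaryless] [IsManifold I 1 M] {W : Type*}
    [NormedAddCommGroup W] [NormedSpace ℝ W] {g : M → W} {p : M}
    (hg : ∀ᶠ q in 𝓝 p, HasMFDerivAt I 𝓘(ℝ, W) g q 0) : ∀ᶠ q in 𝓝 p, g q = g p := by
  set φ := extChartAt I p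
  have hsymm : ContinuousAt φ.symm (φ p) := continuousAt_extChartAt_symm p
  obtain ⟨r, hr, hball⟩ := Metric.mem_nhds_iff.1 <| Filter.inter_mem (extChartAt_target_mem_nhds p)
    (hsymm.preimage_mem_nhds (by rwa [extChartAt_to_inv]))
  have hderiv (y) (hy : y ∈ Metric.ball (φ p) r) : HasFDerivAt (g ∘ φ.symm) (0 : E →L[ℝ] W) y := by
    have hd : MDifferentiableAt 𝓘(ℝ, E) I φ.symm y := by
      have h := mdifferentiableWithinAt_extChartAt_symm (I := I) (hball hy).1
      rwa [I.range_eq_univ, mdifferentiableWithinAt_univ] at h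
    have h := (HasMFDerivAt.comp y (hball hy).2 hd.hasMFDerivAt).hasFDerivAt
    exact h.congr_fderiv (ContinuousLinearMap.zero_comp _)
  have hconst (y) (hy : y ∈ Metric.ball (φ p) r) : g (φ.symm y) = g (φ.symm (φ p)) :=
    Metric.isOpen_ball.is_const_of_fderiv_eq_zero (f := g ∘ φ.symm) (𝕜 := ℝ)
      (convex_ball _ r).isPreconnected
      (fun z hz => (hderiv z hz).differentiableAt.differentiableWithinAt)
      (fun z hz => (hderiv z hz).fderiv) hy (Metric.mem_ball_self hr)
  filter_upwards [extChartAt_source_mem_nhds (I := I) p,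
    (continuousAt_extChartAt (I := I) p).preimage_mem_nhds (Metric.ball_mem_nhds _ hr)]
    with q hq hqr
  have h := hconst (φ q) hqr
  rwa [φ.left_inv hq, extChartAt_to_inv] at h

theorem exists_isOpen_restr_isPreconnected {X F : Type*} [TopologicalSpace X]
    [NormedAddCommGroup F] [NormedSpace ℝ F] (e : OpenPartialHomeomorph X F) {p : X}
    (hp : p ∈ e.source) {U : Set X} (hU : U ∈ 𝓝 p) :
    ∃ s, IsOpen s ∧ p ∈ (e.restr s).source ∧ (e.restr s).source ⊆ U ∧
      IsPreconnected (e.restr s).target := by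
  have hnhds : e.target ∩ e.symm ⁻¹' U ∈ 𝓝 (e p) :=
    Filter.inter_mem (e.open_target.mem_nhds (e.map_source hp))
      ((e.symm.continuousAt (e.map_source hp)).preimage_mem_nhds (by rwa [e.left_inv hp]))
  obtain ⟨r, hr, hball⟩ := Metric.mem_nhds_iff.1 hnhds
  set s := e.source ∩ e ⁻¹' Metric.ball (e p) r
  have hs : IsOpen s := e.isOpen_inter_preimage Metric.isOpen_ball
  have hsource : (e.restr s).source = s := by
    rw [e.restr_source' s hs, ← Set.inter_assoc, Set.inter_self]
  have htarget : (e.restr s).target = Metric.ball (e p) r := by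
    rw [← (e.restr s).image_source_eq_target, hsource, e.restr_apply, e.image_source_inter_eq']
    ext y
    refine ⟨fun hy => ?_, fun hy => ⟨(hball hy).1, ?_⟩⟩
    · exact e.right_inv hy.1 ▸ hy.2
    · rwa [Set.mem_preimage, Set.mem_preimage, e.right_inv (hball hy).1]
  refine ⟨s, hs, by rw [hsource]; exact ⟨hp, Metric.mem_ball_self hr⟩, fun q hq => ?_,
    htarget ▸ (convex_ball _ _).isPreconnected⟩
  rw [hsource] at hq
  have hqU : e.symm (e q) ∈ U := (hball hq.2).2
  rwa [e.left_inv hq.1] at hqU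

end Manifold

section Charts

variable {E : Type*} [NormedAddCommGroup E] [NormedSpace ℝ E] {M : Type*} [TopologicalSpace M]
  [ChartedSpace E M]

theorem mdifferentiable_of_mem_maximalAtlas {e : OpenPartialHomeomorph M E}
    (he : e ∈ IsManifold.maximalAtlas 𝓘(ℝ, E) ∞ M) : e.MDifferentiable 𝓘(ℝ, E) 𝓘(ℝ, E) :=
  ⟨(contMDiffOn_of_mem_maximalAtlas he).mdifferentiableOn (by simp),
    (contMDiffOn_symm_of_mem_maximalAtlas he).mdifferentiableOn (by simp)⟩

theorem exists_mem_maximalAtlas_of_isInvertible_mfderiv [IsManifold 𝓘(ℝ, E) ∞ M]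
    [CompleteSpace E] {x : M → E} {U : Set M}
    (hU : IsOpen U) (hx : ContMDiffOn 𝓘(ℝ, E) 𝓘(ℝ, E) ∞ x U)
    (hinv : ∀ q ∈ U, (mfderiv 𝓘(ℝ, E) 𝓘(ℝ, E) x q).IsInvertible) {p : M} (hp : p ∈ U) :
    ∃ e ∈ IsManifold.maximalAtlas 𝓘(ℝ, E) ∞ M, p ∈ e.source ∧ e.source ⊆ U ∧
      Set.EqOn e x e.source := by
  let φ := chartAt E p
  have hφsymm : ContMDiffOn 𝓘(ℝ, E) 𝓘(ℝ, E) ∞ φ.symm φ.target := contMDiffOn_chart_symm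
  have hBo : IsOpen (φ.target ∩ φ.symm ⁻¹' U) := φ.isOpen_inter_preimage_symm hU
  have hxB : ContDiffOn ℝ ∞ (x ∘ φ.symm) (φ.target ∩ φ.symm ⁻¹' U) :=
    (hx.comp (hφsymm.mono Set.inter_subset_left) fun y hy => hy.2).contDiffOn
  have hinvB (y) (hy : y ∈ φ.target ∩ φ.symm ⁻¹' U) :
      (fderiv ℝ (x ∘ φ.symm) y).IsInvertible := by
    have hφ := (mdifferentiable_of_mem_maximalAtlas
      (IsManifold.chart_mem_maximalAtlas (I := 𝓘(ℝ, E)) (n := ∞) p)).symm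
    rw [← mfderiv_eq_fderiv, mfderiv_comp y
      ((hx.contMDiffAt (hU.mem_nhds hy.2)).mdifferentiableAt (by simp)) (hφ.mdifferentiableAt hy.1)]
    exact (hinv _ hy.2).comp ⟨hφ.mfderiv hy.1, rfl⟩
  obtain ⟨g, hgx, hpg, hgB, hgsymm⟩ := exists_openPartialHomeomorph_of_isInvertible_fderiv hBo hxB
    hinvB (y₀ := φ p) ⟨mem_chart_target E p, by
      rwa [Set.mem_preimage, φ.left_inv (mem_chart_source E p)]⟩
  have hEqOn : Set.EqOn (φ.trans g) x (φ.trans g).source := fun q hq => by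
    have h : g (φ q) = x (φ.symm (φ q)) := congrFun hgx (φ q)
    rwa [φ.left_inv hq.1] at h
  have hsub : (φ.trans g).source ⊆ U := fun q hq => by
    have h : φ.symm (φ q) ∈ U := (hgB hq.2).2
    rwa [φ.left_inv hq.1] at h
  refine ⟨φ.trans g, OpenPartialHomeomorph.mem_maximalAtlas_of_contMDiffOn _
    ((hx.mono hsub).congr hEqOn) ?_, ⟨mem_chart_source E p, hpg⟩, hsub, hEqOn⟩
  exact hφsymm.comp (hgsymm.contMDiffOn.mono fun y hy => hy.1) fun y hy => hy.2

end Charts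

section CovariantDerivative

open Bundle

theorem cov_sum {𝕜 E H M F ι : Type*} [NontriviallyNormedField 𝕜] [NormedAddCommGroup E]
    [NormedSpace 𝕜 E] [TopologicalSpace H] {I : ModelWithCorners 𝕜 E H} [TopologicalSpace M]
    [ChartedSpace H M] [NormedAddCommGroup F] [NormedSpace 𝕜 F] {V : M → Type*}
    [TopologicalSpace (TotalSpace F V)] [∀ x, AddCommGroup (V x)] [∀ x, Module 𝕜 (V x)]
    [∀ x, TopologicalSpace (V x)] [∀ x, IsTopologicalAddGroup (V x)]
    [∀ x, ContinuousSMul 𝕜 (V x)] [FiberBundle F V] [VectorBundle 𝕜 F V]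
    (cov : CovariantDerivative I F V) {s : Finset ι} {σ : ι → Π x, V x} {p : M}
    (hσ : ∀ i, MDifferentiableAt I (I.prod 𝓘(𝕜, F)) (fun q => TotalSpace.mk' F q (σ i q)) p) :
    cov (∑ i ∈ s, σ i) p = ∑ i ∈ s, cov (σ i) p := by
  classical
  induction s using Finset.induction_on with
  | empty => simp only [Finset.sum_empty, CovariantDerivative.zero, Pi.zero_apply]
  | insert i s hi ih =>
    have hsum := MDifferentiableAt.sum_section (s := s) fun j _ => hσ j
    simp only [← Finset.sum_apply] at hsum
    rw [Finset.sum_insert hi, Finset.sum_insert hi, ← ih]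
    exact cov.isCovariantDerivativeOnUniv.add (hσ i) hsum

end CovariantDerivative

section Frame

variable {n : ℕ} {M : Type*} [TopologicalSpace M] [ChartedSpace (RModel n) M]

/-- The linear map `c ↦ ∑ cᵢ Xᵢ(p)` determined by the fields `X`. -/
def frameMap (X : Fin n → Π p : M, TangentSpace (𝓡 n) p) (p : M) :
    RModel n →L[ℝ] TangentSpace (𝓡 n) p :=
  ∑ i, (EuclideanSpace.proj i : RModel n →L[ℝ] ℝ).smulRight (X i p)

/-- The coordinates of a tangent vector at `p` in the frame `X`; junk where `X` is not a frame. -/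
def coframe (X : Fin n → Π p : M, TangentSpace (𝓡 n) p) (p : M) :
    TangentSpace (𝓡 n) p →L[ℝ] RModel n :=
  (frameMap X p).inverse

/-- The coordinates in the frame `X`, as a function on the tangent bundle. -/
def frameCoord (X : Fin n → Π p : M, TangentSpace (𝓡 n) p) (u : TangentBundle (𝓡 n) M) : RModel n :=
  coframe X u.proj u.2

theorem frameMap_apply (X : Fin n → Π p : M, TangentSpace (𝓡 n) p) (p : M) (c : RModel n) :
    frameMap X p c = ∑ i, c i • X i p := by
  rw [frameMap, sum_apply]
  rfl

variable [IsManifold (𝓡 n) ∞ M] {X : Fin n → Π p : M, TangentSpace (𝓡 n) p}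

/-- `frameMap X q`, read in the trivialization of the tangent bundle at `p₀`. -/
def trivFrame (X : Fin n → Π p : M, TangentSpace (𝓡 n) p) (p₀ q : M) : RModel n →L[ℝ] RModel n :=
  ∑ i, (EuclideanSpace.proj i : RModel n →L[ℝ] ℝ).smulRight
    (trivializationAt (RModel n) (TangentSpace (𝓡 n)) p₀ ⟨q, X i q⟩).2

/-- Smooth global frames of the tangent bundle. -/
structure IsFrame (X : Fin n → Π p : M, TangentSpace (𝓡 n) p) : Prop where
  smooth : ∀ i, IsSmoothField (X i)
  isInvertible : ∀ p, (frameMap X p).IsInvertible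

/-- Global frames of parallel vector fields. -/
structure IsParallelFrame (cov : Conn n M) (X : Fin n → Π p : M, TangentSpace (𝓡 n) p) : Prop
    extends IsFrame X where
  parallel : ∀ i p, cov (X i) p = 0

/-- Differentiability of a vector field at a point. -/
abbrev IsDiffFieldAt (σ : Π p : M, TangentSpace (𝓡 n) p) (p : M) : Prop :=
  MDifferentiableAt (𝓡 n) (𝓡 n).tangent (fun q => (⟨q, σ q⟩ : TangentBundle (𝓡 n) M)) p

theorem IsGenerator.isParallelFrame {cov : Conn n M} {L : Set (TangentBundle (𝓡 n) M)}
    (hX : IsGenerator cov L X) : IsParallelFrame cov X where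
  smooth := hX.smooth
  parallel := hX.parallel
  isInvertible p := by
    have hinj : Function.Injective (frameMap X p : RModel n →ₗ[ℝ] TangentSpace (𝓡 n) p) := by
      rw [injective_iff_map_eq_zero]
      intro c hc
      ext i
      refine Fintype.linearIndependent_iff.1 (hX.linearIndependent p) (fun i => c i) ?_ i
      exact (frameMap_apply X p c).symm.trans hc
    let e : RModel n ≃ₗ[ℝ] RModel n := LinearEquiv.ofInjectiveEndo
      (show RModel n →ₗ[ℝ] RModel n from (frameMap X p : RModel n →ₗ[ℝ] TangentSpace (𝓡 n) p)) hinj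
    exact ⟨(show RModel n ≃L[ℝ] TangentSpace (𝓡 n) p from e.toContinuousLinearEquiv), rfl⟩

namespace IsFrame

theorem isInvertible_coframe (hX : IsFrame X) (p : M) : (coframe X p).IsInvertible :=
  (hX.isInvertible p).inverse

theorem frameMap_coframe (hX : IsFrame X) (p : M) (v : TangentSpace (𝓡 n) p) :
    frameMap X p (coframe X p v) = v :=
  (hX.isInvertible p).self_apply_inverse v

theorem coframe_frameMap (hX : IsFrame X) (p : M) (c : RModel n) :
    coframe X p (frameMap X p c) = c :=
  (hX.isInvertible p).inverse_apply_self c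

theorem coframe_injective (hX : IsFrame X) (p : M) : Function.Injective (coframe X p) :=
  (hX.isInvertible_coframe p).injective

end IsFrame

theorem trivFrame_eq_comp (X : Fin n → Π p : M, TangentSpace (𝓡 n) p) {p₀ q : M}
    (hq : q ∈ (chartAt (RModel n) p₀).source) :
    trivFrame X p₀ q = (trivializationAt (RModel n) (TangentSpace (𝓡 n)) p₀).continuousLinearMapAt
      ℝ q ∘L frameMap X q := by
  ext1 c
  rw [ContinuousLinearMap.comp_apply, frameMap_apply, map_sum, trivFrame, sum_apply]
  refine Finset.sum_congr rfl fun i _ => ?_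
  rw [map_smul, Bundle.Trivialization.continuousLinearMapAt_apply,
    Bundle.Trivialization.coe_linearMapAt_of_mem _ (by exact hq)]
  rfl

namespace IsFrame

theorem isInvertible_trivFrame (hX : IsFrame X) {p₀ q : M}
    (hq : q ∈ (chartAt (RModel n) p₀).source) : (trivFrame X p₀ q).IsInvertible := by
  rw [trivFrame_eq_comp X hq]
  refine ContinuousLinearMap.IsInvertible.comp ?_ (hX.isInvertible q)
  exact ⟨(trivializationAt (RModel n) (TangentSpace (𝓡 n)) p₀).continuousLinearEquivAt ℝ q hq,
    Bundle.Trivialization.coe_continuousLinearEquivAt_eq' _ hq⟩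

theorem frameCoord_eq (hX : IsFrame X) {p₀ : M} {u : TangentBundle (𝓡 n) M}
    (hu : u.proj ∈ (chartAt (RModel n) p₀).source) :
    frameCoord X u = (trivFrame X p₀ u.proj).inverse
      (trivializationAt (RModel n) (TangentSpace (𝓡 n)) p₀ u).2 := by
  symm
  rw [frameCoord, (hX.isInvertible_trivFrame hu).inverse_apply_eq, trivFrame_eq_comp X hu,
    ContinuousLinearMap.comp_apply, hX.frameMap_coframe,
    Bundle.Trivialization.continuousLinearMapAt_apply,
    Bundle.Trivialization.coe_linearMapAt_of_mem _ (by exact hu)]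

theorem contMDiffAt_trivFrame (hX : IsFrame X) {p₀ q : M}
    (hq : q ∈ (chartAt (RModel n) p₀).source) :
    ContMDiffAt (𝓡 n) 𝓘(ℝ, RModel n →L[ℝ] RModel n) ∞ (trivFrame X p₀) q := by
  refine ContMDiffAt.sum fun i _ => ?_
  have h := ((trivializationAt (RModel n) (TangentSpace (𝓡 n)) p₀).contMDiffAt_section_iff
    (IB := 𝓡 n) (n := ∞) (s := X i) hq).1 (hX.smooth i q)
  exact ((ContinuousLinearMap.smulRightL ℝ (RModel n) (RModel n)
    (EuclideanSpace.proj i : RModel n →L[ℝ] ℝ)).contDiff.contDiffAt.contMDiffAt).comp q h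

theorem contMDiffAt_inverse_trivFrame (hX : IsFrame X) {p₀ q : M}
    (hq : q ∈ (chartAt (RModel n) p₀).source) :
    ContMDiffAt (𝓡 n) 𝓘(ℝ, RModel n →L[ℝ] RModel n) ∞ (fun q => (trivFrame X p₀ q).inverse) q :=
  ((hX.isInvertible_trivFrame hq).contDiffAt_map_inverse.contMDiffAt).comp q
    (hX.contMDiffAt_trivFrame hq)

theorem frameCoord_eventuallyEq (hX : IsFrame X) (u : TangentBundle (𝓡 n) M) :
    frameCoord X =ᶠ[𝓝 u] fun v => (trivFrame X u.proj v.proj).inverse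
      (trivializationAt (RModel n) (TangentSpace (𝓡 n)) u.proj v).2 := by
  have hproj : ContinuousAt (Bundle.TotalSpace.proj : TangentBundle (𝓡 n) M → M) u :=
    (FiberBundle.continuous_proj (RModel n) (TangentSpace (𝓡 n))).continuousAt
  filter_upwards [hproj.preimage_mem_nhds
    ((chartAt (RModel n) u.proj).open_source.mem_nhds (mem_chart_source _ _))] with v hv
  exact hX.frameCoord_eq hv

theorem contMDiff_frameCoord (hX : IsFrame X) :
    ContMDiff (𝓡 n).tangent 𝓘(ℝ, RModel n) ∞ (frameCoord X) := by
  intro u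
  refine ContMDiffAt.congr_of_eventuallyEq ?_ (hX.frameCoord_eventuallyEq u)
  refine ContMDiffAt.clm_apply ?_ ?_
  · exact (hX.contMDiffAt_inverse_trivFrame (mem_chart_source _ _)).comp u
      (Bundle.contMDiff_proj (n := ∞) (IB := 𝓡 n) (TangentSpace (𝓡 n) : M → Type _)).contMDiffAt
  · exact (Bundle.contMDiffAt_totalSpace.1 contMDiffAt_id).2

theorem mdifferentiableAt_coframe (hX : IsFrame X) {σ : Π p : M, TangentSpace (𝓡 n) p} {p : M}
    (hσ : IsDiffFieldAt σ p) :
    MDifferentiableAt (𝓡 n) 𝓘(ℝ, RModel n) (fun q => coframe X q (σ q)) p :=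
  ((hX.contMDiff_frameCoord.mdifferentiable (by simp)) ⟨p, σ p⟩).comp p hσ

end IsFrame

variable {cov : Conn n M}

theorem IsParallelFrame.coframe_cov (hX : IsParallelFrame cov X)
    {σ : Π p : M, TangentSpace (𝓡 n) p} {p : M} (hσ : IsDiffFieldAt σ p)
    (a : TangentSpace (𝓡 n) p) :
    coframe X p (cov σ p a) = mvfderiv (𝓡 n) (fun q => coframe X q (σ q)) p a := by
  have hcoord (i) : HasMFDerivAt (𝓡 n) 𝓘(ℝ, ℝ) (fun q => coframe X q (σ q) i) p
      ((EuclideanSpace.proj i : RModel n →L[ℝ] ℝ).comp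
        (mvfderiv (𝓡 n) (fun q => coframe X q (σ q)) p)) :=
    ((EuclideanSpace.proj i : RModel n →L[ℝ] ℝ).hasMFDerivAt).comp p
      (hX.mdifferentiableAt_coframe hσ).hasMFDerivAt
  have hXi (i) : IsDiffFieldAt (X i) p := (hX.smooth i p).mdifferentiableAt (by simp)
  have hsum : σ = ∑ i, (fun q => coframe X q (σ q) i) • X i := by
    funext q
    rw [Finset.sum_apply]
    exact (hX.frameMap_coframe q (σ q)).symm.trans (frameMap_apply X q _)
  suffices h : cov σ p a = frameMap X p (mvfderiv (𝓡 n) (fun q => coframe X q (σ q)) p a) by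
    rw [h, hX.coframe_frameMap]
  conv_lhs => rw [hsum]
  rw [cov_sum cov fun i => (hcoord i).mdifferentiableAt.smul_section (hXi i), sum_apply,
    frameMap_apply]
  refine Finset.sum_congr rfl fun i _ => ?_
  rw [cov.isCovariantDerivativeOnUniv.leibniz (hXi i) (hcoord i).mdifferentiableAt,
    hX.parallel i p, smul_zero, zero_add, ContinuousLinearMap.smulRight_apply, mvfderiv,
    (hcoord i).mfderiv]
  rfl

end Frame

section Connector

variable {n : ℕ} {M : Type*} [TopologicalSpace M] [ChartedSpace (RModel n) M]
  [IsManifold (𝓡 n) ∞ M] {X : Fin n → Π p : M, TangentSpace (𝓡 n) p} {cov : Conn n M}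

theorem hasMFDerivAt_proj (u : TangentBundle (𝓡 n) M) :
    HasMFDerivAt (𝓡 n).tangent (𝓡 n) (Bundle.TotalSpace.proj : TangentBundle (𝓡 n) M → M) u
      (ContinuousLinearMap.fst ℝ (RModel n) (RModel n)) := by
  have h := ((Bundle.contMDiff_proj (n := ∞) (IB := 𝓡 n)
    (TangentSpace (𝓡 n) : M → Type _)).mdifferentiable (by simp) u).hasMFDerivAt
  refine h.congr_mfderiv ?_
  ext1 A
  exact projDeriv_ofCoord u (show RModel n × RModel n from A).1 (show RModel n × RModel n from A).2

theorem hasMFDerivAt_trivializationAt_snd (u : TangentBundle (𝓡 n) M) :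
    HasMFDerivAt (𝓡 n).tangent 𝓘(ℝ, RModel n)
      (fun v : TangentBundle (𝓡 n) M =>
        (trivializationAt (RModel n) (TangentSpace (𝓡 n)) u.proj v).2) u
      (ContinuousLinearMap.snd ℝ (RModel n) (RModel n)) := by
  have h := (mdifferentiableAt_extChartAt (I := (𝓡 n).tangent)
    (mem_chart_source (ModelProd (RModel n) (RModel n)) u)).hasMFDerivAt
  rw [mfderiv_extChartAt_self] at h
  exact ((ContinuousLinearMap.snd ℝ (RModel n) (RModel n)).hasMFDerivAt).comp u h

theorem trivializationAt_self_snd (p : M) (w : TangentSpace (𝓡 n) p) :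
    (trivializationAt (RModel n) (TangentSpace (𝓡 n)) p ⟨p, w⟩).2 = w := by
  have h := TangentBundle.continuousLinearMapAt_trivializationAt (I := 𝓡 n)
    (mem_chart_source (RModel n) p)
  rw [mfderiv_extChartAt_self] at h
  refine Eq.trans ?_ (congrArg (fun T => T w) h)
  exact (congrFun (Bundle.Trivialization.coe_linearMapAt_of_mem (R := ℝ) _
    (by exact mem_chart_source (RModel n) p)) w).symm

theorem IsParallelFrame.coframe_christoffel (hX : IsParallelFrame cov X)
    (u : TangentBundle (𝓡 n) M) (a : TangentSpace (𝓡 n) u.proj) :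
    coframe X u.proj (christoffel cov u a)
      = mvfderiv (𝓡 n) (fun q => (trivFrame X u.proj q).inverse) u.proj a u.2 := by
  have hp := mem_chart_source (RModel n) u.proj
  have hconst : (fun q => coframe X q (FiberBundle.extend (RModel n) u.2 q)) =ᶠ[𝓝 u.proj]
      fun q => (trivFrame X u.proj q).inverse u.2 := by
    filter_upwards [(chartAt (RModel n) u.proj).open_source.mem_nhds hp] with q hq
    refine (hX.frameCoord_eq (u := ⟨q, FiberBundle.extend (RModel n) u.2 q⟩) hq).trans ?_
    refine congrArg (trivFrame X u.proj q).inverse ?_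
    refine (congrArg Prod.snd (Bundle.Trivialization.apply_mk_symm _ (by exact hq) _)).trans ?_
    exact trivializationAt_self_snd u.proj u.2
  have hderiv : HasMFDerivAt (𝓡 n) 𝓘(ℝ, RModel n)
      (fun q => coframe X q (FiberBundle.extend (RModel n) u.2 q)) u.proj
      ((show RModel n →L[ℝ] RModel n →L[ℝ] RModel n from mfderiv (𝓡 n) 𝓘(ℝ, RModel n →L[ℝ] RModel n)
        (fun q => (trivFrame X u.proj q).inverse) u.proj).flip u.2) := by
    refine ((hasMFDerivAt_clm_apply ((hX.contMDiffAt_inverse_trivFrame hp).mdifferentiableAt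
      (by simp)).hasMFDerivAt (hasMFDerivAt_const (show RModel n from u.2)
        u.proj)).congr_of_eventuallyEq hconst).congr_mfderiv ?_
    exact (congrArg (· + _) (ContinuousLinearMap.comp_zero _)).trans (zero_add _)
  refine (hX.coframe_cov (FiberBundle.mdifferentiableAt_extend ..) a).trans ?_
  rw [mvfderiv, hderiv.mfderiv]
  rfl

theorem IsParallelFrame.mvfderiv_frameCoord (hX : IsParallelFrame cov X)
    (u : TangentBundle (𝓡 n) M) (A : TangentSpace (𝓡 n).tangent u) :
    mvfderiv (𝓡 n).tangent (frameCoord X) u A = coframe X u.proj (connector cov u A) := by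
  have hp := mem_chart_source (RModel n) u.proj
  have hS := ((hX.contMDiffAt_inverse_trivFrame hp).mdifferentiableAt (by simp)).hasMFDerivAt
  have hderiv := (hasMFDerivAt_clm_apply (hS.comp u (hasMFDerivAt_proj u))
    (hasMFDerivAt_trivializationAt_snd u)).congr_of_eventuallyEq (hX.frameCoord_eventuallyEq u)
  have hfibre : coframe X u.proj (fibreCoord u A)
      = (trivFrame X u.proj u.proj).inverse (fibreCoord u A) := by
    refine (hX.frameCoord_eq (u := ⟨u.proj, fibreCoord u A⟩) hp).trans ?_
    rw [trivializationAt_self_snd]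
  have hproj : projDeriv u A = (show RModel n × RModel n from A).1 :=
    congrArg (fun T => T A) (hasMFDerivAt_proj u).mfderiv
  rw [mvfderiv, hderiv.mfderiv, connector, map_add, hX.coframe_christoffel, hfibre, hproj,
    ← trivializationAt_self_snd u.proj u.2]
  rfl

end Connector

section AdaptedChart

variable {n : ℕ} {M : Type*} [TopologicalSpace M] [ChartedSpace (RModel n) M]
  {X : Fin n → Π p : M, TangentSpace (𝓡 n) p}

/-- Smooth charts whose coordinate fields are the fields of the frame `X`. -/
def IsAdaptedChart (X : Fin n → Π p : M, TangentSpace (𝓡 n) p)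
    (e : OpenPartialHomeomorph M (RModel n)) : Prop :=
  e ∈ IsManifold.maximalAtlas (𝓡 n) ∞ M ∧
    ∀ q ∈ e.source, mfderiv (𝓡 n) 𝓘(ℝ, RModel n) e q = coframe X q

namespace IsAdaptedChart

variable {e : OpenPartialHomeomorph M (RModel n)}

theorem restr (he : IsAdaptedChart X e) {s : Set M} (hs : IsOpen s) :
    IsAdaptedChart X (e.restr s) :=
  ⟨restr_mem_maximalAtlas (contDiffGroupoid ∞ (𝓡 n)) he.1 hs, fun q hq => he.2 q hq.1⟩

theorem hasMFDerivAt (he : IsAdaptedChart X e) {q : M} (hq : q ∈ e.source) :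
    HasMFDerivAt (𝓡 n) 𝓘(ℝ, RModel n) e q (coframe X q) :=
  he.2 q hq ▸ ((mdifferentiable_of_mem_maximalAtlas he.1).mdifferentiableAt hq).hasMFDerivAt

end IsAdaptedChart

end AdaptedChart

section ExistsAdaptedChart

variable {n : ℕ} {M : Type*} [TopologicalSpace M] [ChartedSpace (RModel n) M]
  [IsManifold (𝓡 n) ∞ M] {X : Fin n → Π p : M, TangentSpace (𝓡 n) p} {cov : Conn n M}

theorem IsFrame.isDiffFieldAt_frameMap (hX : IsFrame X) (c : RModel n) (p : M) :
    IsDiffFieldAt (fun q => frameMap X q c) p := by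
  have h : ContMDiff (𝓡 n) (𝓡 n).tangent ∞
      (fun q => (⟨q, ∑ i, (c i • X i) q⟩ : TangentBundle (𝓡 n) M)) :=
    ContMDiff.sum_section (t := fun i => c i • X i) fun i _ =>
      ContMDiff.const_smul_section (a := c i) (hX.smooth i)
  unfold IsDiffFieldAt
  simp only [frameMap_apply]
  exact (h p).mdifferentiableAt (by simp)

theorem IsParallelFrame.cov_frameMap (hX : IsParallelFrame cov X) (c : RModel n) (p : M) :
    cov (fun q => frameMap X q c) p = 0 := by
  ext1 a
  apply hX.coframe_injective p
  rw [hX.coframe_cov (hX.isDiffFieldAt_frameMap c p)]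
  simp only [hX.coframe_frameMap, mvfderiv_const]
  exact (map_zero (coframe X p)).symm

theorem IsParallelFrame.mlieBracket_frameMap (hX : IsParallelFrame cov X)
    (htor : ∀ p, cov.torsion p = 0) (b c : RModel n) (p : M) :
    VectorField.mlieBracket (𝓡 n) (fun q => frameMap X q b) (fun q => frameMap X q c) p = 0 := by
  have h := cov.torsion_apply (hX.isDiffFieldAt_frameMap b p) (hX.isDiffFieldAt_frameMap c p)
  rw [htor, hX.cov_frameMap, hX.cov_frameMap] at h
  simpa using h.symm

theorem mpullback_extChartAt_symm_frameMap (X : Fin n → Π p : M, TangentSpace (𝓡 n) p) {p₀ : M}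
    {y : RModel n} (hy : y ∈ (extChartAt (𝓡 n) p₀).target) (c : RModel n) :
    VectorField.mpullback 𝓘(ℝ, RModel n) (𝓡 n) (extChartAt (𝓡 n) p₀).symm
      (fun q => frameMap X q c) y = trivFrame X p₀ ((extChartAt (𝓡 n) p₀).symm y) c := by
  have hq : (extChartAt (𝓡 n) p₀).symm y ∈ (chartAt (RModel n) p₀).source := by
    rw [← extChartAt_source (𝓡 n)]
    exact (extChartAt (𝓡 n) p₀).map_target hy
  have hcomp := mfderiv_extChartAt_comp_mfderivWithin_extChartAt_symm hy
  have hcomp' := mfderivWithin_extChartAt_symm_comp_mfderiv_extChartAt hy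
  rw [ModelWithCorners.range_eq_univ, mfderivWithin_univ] at hcomp hcomp'
  rw [VectorField.mpullback_apply, ContinuousLinearMap.inverse_eq hcomp' hcomp,
    trivFrame_eq_comp X hq, TangentBundle.continuousLinearMapAt_trivializationAt hq]
  rfl

theorem IsParallelFrame.lieBracket_trivFrame (hX : IsParallelFrame cov X)
    (htor : ∀ p, cov.torsion p = 0) {p₀ : M} {y : RModel n}
    (hy : y ∈ (extChartAt (𝓡 n) p₀).target) (b c : RModel n) :
    VectorField.lieBracket ℝ (fun z => trivFrame X p₀ ((extChartAt (𝓡 n) p₀).symm z) b)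
      (fun z => trivFrame X p₀ ((extChartAt (𝓡 n) p₀).symm z) c) y = 0 := by
  have : IsManifold (𝓡 n) (minSmoothness ℝ 2) M := by
    rw [minSmoothness_of_isRCLikeNormedField]
    infer_instance
  have hsymm : ContMDiffAt 𝓘(ℝ, RModel n) (𝓡 n) ∞ (extChartAt (𝓡 n) p₀).symm y :=
    (contMDiffOn_extChartAt_symm p₀).contMDiffAt (extChartAt_target_mem_nhds' hy)
  have hpull (a : RModel n) :
      VectorField.mpullback 𝓘(ℝ, RModel n) (𝓡 n) (extChartAt (𝓡 n) p₀).symm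
        (fun q => frameMap X q a) =ᶠ[𝓝 y]
      fun z => trivFrame X p₀ ((extChartAt (𝓡 n) p₀).symm z) a := by
    filter_upwards [extChartAt_target_mem_nhds' hy] with z hz
    exact mpullback_extChartAt_symm_frameMap X hz a
  have h := VectorField.mpullback_mlieBracket (hX.isDiffFieldAt_frameMap b _)
    (hX.isDiffFieldAt_frameMap c _) hsymm (by
      rw [minSmoothness_of_isRCLikeNormedField]
      exact WithTop.coe_le_coe.2 le_top)
  rw [(hpull b).mlieBracket_vectorField_eq (hpull c), VectorField.mpullback_apply,
    hX.mlieBracket_frameMap htor, map_zero] at h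
  exact (congrFun (mlieBracket_eq_lieBracket _ _) y).symm.trans h.symm

/-- In a chart, the coframe dual to a parallel frame of a torsion-free connection is closed. -/
theorem IsParallelFrame.exists_primitive (hX : IsParallelFrame cov X)
    (htor : ∀ p, cov.torsion p = 0) (p₀ : M) :
    ∃ B ⊆ (extChartAt (𝓡 n) p₀).target, ∃ x : RModel n → RModel n, IsOpen B ∧
      extChartAt (𝓡 n) p₀ p₀ ∈ B ∧ ContDiffOn ℝ ∞ x B ∧
      ∀ y ∈ B, HasFDerivAt x (trivFrame X p₀ ((extChartAt (𝓡 n) p₀).symm y)).inverse y := by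
  obtain ⟨r, hr, hball⟩ := Metric.isOpen_iff.1 (isOpen_extChartAt_target (I := 𝓡 n) p₀)
    (extChartAt (𝓡 n) p₀ p₀) (mem_extChartAt_target p₀)
  set B := Metric.ball (extChartAt (𝓡 n) p₀ p₀) r
  have hsource (y) (hy : y ∈ B) :
      (extChartAt (𝓡 n) p₀).symm y ∈ (chartAt (RModel n) p₀).source := by
    rw [← extChartAt_source (𝓡 n)]
    exact (extChartAt (𝓡 n) p₀).map_target (hball hy)
  have hsymm (y) (hy : y ∈ B) :
      ContMDiffAt 𝓘(ℝ, RModel n) (𝓡 n) ∞ (extChartAt (𝓡 n) p₀).symm y :=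
    (contMDiffOn_extChartAt_symm p₀).contMDiffAt (extChartAt_target_mem_nhds' (hball hy))
  have hframe (y) (hy : y ∈ B) : ContDiffAt ℝ ∞
      (fun z => trivFrame X p₀ ((extChartAt (𝓡 n) p₀).symm z)) y :=
    ((hX.contMDiffAt_trivFrame (hsource y hy)).comp y (hsymm y hy)).contDiffAt
  have hcoframe : ContDiffOn ℝ ∞
      (fun z => (trivFrame X p₀ ((extChartAt (𝓡 n) p₀).symm z)).inverse) B := fun y hy =>
    ((hX.contMDiffAt_inverse_trivFrame (hsource y hy)).comp y
      (hsymm y hy)).contDiffAt.contDiffWithinAt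
  obtain ⟨x, hx⟩ := (convex_ball (extChartAt (𝓡 n) p₀ p₀)
    r).exists_forall_hasFDerivAt_of_fderiv_symmetric Metric.isOpen_ball
    (hcoframe.differentiableOn (by simp)) fun y hy =>
      fderiv_inverse_symm ((hframe y hy).differentiableAt (by simp))
        (hX.isInvertible_trivFrame (hsource y hy))
        (hX.lieBracket_trivFrame htor (hball hy))
  refine ⟨B, hball, x, Metric.isOpen_ball, Metric.mem_ball_self hr, ?_, hx⟩
  rw [contDiffOn_infty_iff_fderiv_of_isOpen Metric.isOpen_ball]
  exact ⟨fun y hy => (hx y hy).differentiableAt.differentiableWithinAt,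
    hcoframe.congr fun y hy => (hx y hy).fderiv⟩

theorem IsParallelFrame.exists_isAdaptedChart (hX : IsParallelFrame cov X)
    (htor : ∀ p, cov.torsion p = 0) (p₀ : M) : ∃ e, IsAdaptedChart X e ∧ p₀ ∈ e.source := by
  obtain ⟨B, hBsub, x, hB, hp₀, hxs, hx⟩ := hX.exists_primitive htor p₀
  set φ := extChartAt (𝓡 n) p₀
  have hU : IsOpen (φ.source ∩ φ ⁻¹' B) :=
    (continuousOn_extChartAt p₀).isOpen_inter_preimage (isOpen_extChartAt_source p₀) hB
  have hsmooth : ContMDiffOn (𝓡 n) 𝓘(ℝ, RModel n) ∞ (x ∘ φ) (φ.source ∩ φ ⁻¹' B) :=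
    hxs.contMDiffOn.comp (contMDiffOn_extChartAt.mono fun q hq => by
      rw [← extChartAt_source (𝓡 n)]; exact hq.1) fun q hq => hq.2
  have hderiv (q) (hq : q ∈ φ.source ∩ φ ⁻¹' B) :
      HasMFDerivAt (𝓡 n) 𝓘(ℝ, RModel n) (x ∘ φ) q (coframe X q) := by
    have hq₁ : q ∈ (chartAt (RModel n) p₀).source := by
      rw [← extChartAt_source (𝓡 n)]; exact hq.1
    refine ((hx _ hq.2).hasMFDerivAt.comp q
      (mdifferentiableAt_extChartAt hq₁).hasMFDerivAt).congr_mfderiv ?_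
    ext1 v
    rw [← TangentBundle.continuousLinearMapAt_trivializationAt hq₁]
    refine Eq.trans ?_ (hX.frameCoord_eq (u := ⟨q, v⟩) hq₁).symm
    change (trivFrame X p₀ (φ.symm (φ q))).inverse _ = _
    rw [φ.left_inv hq.1]
    exact congrArg (trivFrame X p₀ q).inverse
      (congrFun (Bundle.Trivialization.coe_linearMapAt_of_mem (R := ℝ) _ (by exact hq₁)) v)
  obtain ⟨e, he, hpe, hsub, heq⟩ := exists_mem_maximalAtlas_of_isInvertible_mfderiv hU hsmooth
    (fun q hq => (hderiv q hq).mfderiv ▸ hX.isInvertible_coframe q)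
    ⟨mem_extChartAt_source p₀, hp₀⟩
  refine ⟨e, ⟨he, fun q hq => ?_⟩, hpe⟩
  have hev : e =ᶠ[𝓝 q] x ∘ φ := heq.eventuallyEq_of_mem (e.open_source.mem_nhds hq)
  exact ((hderiv q (hsub hq)).congr_of_eventuallyEq hev).mfderiv

theorem IsAdaptedChart.coordField_eq {e : OpenPartialHomeomorph M (RModel n)}
    (he : IsAdaptedChart X e) (hX : IsFrame X) {q : M} (hq : q ∈ e.source)
    (v : RModel n) : coordField e v q = frameMap X q v := by
  have h : coordField e v q = (coframe X q).inverse v :=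
    congrArg (fun T => T.inverse v) (he.2 q hq)
  rw [h, (hX.isInvertible_coframe q).inverse_apply_eq, hX.coframe_frameMap]

theorem isDiffFieldAt_coordField {e : OpenPartialHomeomorph M (RModel n)}
    (he : e ∈ IsManifold.maximalAtlas (𝓡 n) ∞ M) (v : RModel n) {q : M} (hq : q ∈ e.source) :
    IsDiffFieldAt (coordField e v) q := by
  have hconst : MDifferentiableAt (𝓡 n) (𝓡 n).tangent
      (fun y => (⟨y, v⟩ : TangentBundle (𝓡 n) (RModel n))) (e q) :=
    (contMDiffAt_vectorSpace_iff_contDiffAt (n := ∞) (V := fun _ => v)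
      |>.2 contDiffAt_const).mdifferentiableAt (by simp)
  exact MDifferentiableAt.mpullback_vectorField (n := ∞) hconst
    (contMDiffAt_of_mem_maximalAtlas he hq)
    ⟨(mdifferentiable_of_mem_maximalAtlas he).mfderiv hq, rfl⟩ (WithTop.coe_le_coe.2 le_top)

theorem IsAdaptedChart.isAffineChart {e : OpenPartialHomeomorph M (RModel n)}
    (he : IsAdaptedChart X e) (hX : IsParallelFrame cov X) : IsAffineChart cov e := by
  refine ⟨he.1, fun v w p hp => ?_⟩
  suffices h : cov (coordField e w) p = 0 by rw [h]; rfl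
  rw [← hX.cov_frameMap w p]
  refine cov.isCovariantDerivativeOnUniv.congr_of_eventuallyEq (isDiffFieldAt_coordField he.1 w hp)
    (hX.isDiffFieldAt_frameMap w p) Filter.univ_mem ?_
  filter_upwards [e.open_source.mem_nhds hp] with q hq
  exact he.coordField_eq hX.toIsFrame hq w

theorem IsParallelFrame.exists_small_isAdaptedChart (hX : IsParallelFrame cov X)
    (htor : ∀ p, cov.torsion p = 0) {p₀ : M} {U : Set M} (hU : U ∈ 𝓝 p₀) :
    ∃ e, IsAdaptedChart X e ∧ p₀ ∈ e.source ∧ e.source ⊆ U ∧ IsPreconnected e.target := by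
  obtain ⟨e, he, hp⟩ := hX.exists_isAdaptedChart htor p₀
  obtain ⟨s, hs, hps, hsub, hconn⟩ := exists_isOpen_restr_isPreconnected e hp hU
  exact ⟨e.restr s, he.restr hs, hps, hsub, hconn⟩

end ExistsAdaptedChart

section CoordField

variable {n d : ℕ}
  {M : Type*} [TopologicalSpace M] [ChartedSpace (RModel n) M]
  {M' : Type*} [TopologicalSpace M'] [ChartedSpace (RModel d) M']
  {e : OpenPartialHomeomorph M (RModel n)} {e' : OpenPartialHomeomorph M' (RModel d)} {f : M → M'}

theorem mfderiv_coordField (he : e ∈ IsManifold.maximalAtlas (𝓡 n) ∞ M) {q : M}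
    (hq : q ∈ e.source) (v : RModel n) : mfderiv (𝓡 n) (𝓡 n) e q (coordField e v q) = v :=
  ContinuousLinearMap.IsInvertible.self_apply_inverse
    ⟨(mdifferentiable_of_mem_maximalAtlas he).mfderiv hq, rfl⟩ v

theorem coordField_mfderiv (he : e ∈ IsManifold.maximalAtlas (𝓡 n) ∞ M) {q : M}
    (hq : q ∈ e.source) (a : TangentSpace (𝓡 n) q) :
    coordField e (mfderiv (𝓡 n) (𝓡 n) e q a) q = a :=
  ContinuousLinearMap.IsInvertible.inverse_apply_self
    ⟨(mdifferentiable_of_mem_maximalAtlas he).mfderiv hq, rfl⟩ a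

theorem mfderiv_apply_coordField (he : e ∈ IsManifold.maximalAtlas (𝓡 n) ∞ M)
    (he' : e' ∈ IsManifold.maximalAtlas (𝓡 d) ∞ M') {q : M} (hq : q ∈ e.source)
    (hfq : f q ∈ e'.source) (hf : MDifferentiableAt (𝓡 n) (𝓡 d) f q) {g : RModel n → RModel d}
    {g' : RModel n →L[ℝ] RModel d} (hg : HasFDerivAt g g' (e q)) (hfg : e' ∘ f =ᶠ[𝓝 q] g ∘ e)
    (v : RModel n) :
    mfderiv (𝓡 n) (𝓡 d) f q (coordField e v q) = coordField e' (g' v) (f q) := by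
  have hleft := ((mdifferentiable_of_mem_maximalAtlas he').mdifferentiableAt hfq).hasMFDerivAt.comp
    q hf.hasMFDerivAt
  have hright := (hg.hasMFDerivAt.comp q ((mdifferentiable_of_mem_maximalAtlas
    he).mdifferentiableAt hq).hasMFDerivAt).congr_of_eventuallyEq hfg
  have hderiv : mfderiv (𝓡 d) (𝓡 d) e' (f q) (mfderiv (𝓡 n) (𝓡 d) f q (coordField e v q))
      = g' (mfderiv (𝓡 n) (𝓡 n) e q (coordField e v q)) :=
    congrArg (fun T => T (coordField e v q)) (hasMFDerivAt_unique hleft hright)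
  rw [← coordField_mfderiv he' hfq (mfderiv (𝓡 n) (𝓡 d) f q (coordField e v q)), hderiv,
    mfderiv_coordField he hq]

end CoordField

section SecondDeriv

variable {n d : ℕ}
  {M : Type*} [TopologicalSpace M] [ChartedSpace (RModel n) M] [IsManifold (𝓡 n) ∞ M]
  {M' : Type*} [TopologicalSpace M'] [ChartedSpace (RModel d) M'] [IsManifold (𝓡 d) ∞ M']
  {cov : Conn n M} {cov' : Conn d M'} {f : M → M'}

/-- The differential `f_** : T(TM) → T(TM')` of `f_* : TM → TM'`. -/
abbrev secondDeriv (n d : ℕ) {M : Type*} [TopologicalSpace M] [ChartedSpace (RModel n) M]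
    [IsManifold (𝓡 n) ∞ M] {M' : Type*} [TopologicalSpace M'] [ChartedSpace (RModel d) M']
    [IsManifold (𝓡 d) ∞ M'] (f : M → M') (u : TangentBundle (𝓡 n) M) :
    TangentSpace (𝓡 n).tangent u →L[ℝ]
      TangentSpace (𝓡 d).tangent (tangentMap (𝓡 n) (𝓡 d) f u) :=
  mfderiv (𝓡 n).tangent (𝓡 d).tangent (tangentMap (𝓡 n) (𝓡 d) f) u

theorem mdifferentiable_tangentMap (hf : ContMDiff (𝓡 n) (𝓡 d) ∞ f) :
    MDifferentiable (𝓡 n).tangent (𝓡 d).tangent (tangentMap (𝓡 n) (𝓡 d) f) :=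
  (hf.contMDiff_tangentMap (m := ∞) (by simp)).mdifferentiable (by simp)

theorem projDeriv_secondDeriv (hf : ContMDiff (𝓡 n) (𝓡 d) ∞ f) (u : TangentBundle (𝓡 n) M)
    (A : TangentSpace (𝓡 n).tangent u) :
    projDeriv (tangentMap (𝓡 n) (𝓡 d) f u) (secondDeriv n d f u A)
      = mfderiv (𝓡 n) (𝓡 d) f u.proj (projDeriv u A) := by
  have hproj (v : TangentBundle (𝓡 n) M) := (hasMFDerivAt_proj v).mdifferentiableAt
  have hproj' := (hasMFDerivAt_proj (tangentMap (𝓡 n) (𝓡 d) f u)).mdifferentiableAt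
  have hleft := mfderiv_comp_apply u hproj' (mdifferentiable_tangentMap hf u) A
  have hright := mfderiv_comp_apply u (hf.mdifferentiable (by simp) u.proj) (hproj u) A
  exact hleft.symm.trans hright

theorem ext_projDeriv_connector {u : TangentBundle (𝓡 n) M} {A B : TangentSpace (𝓡 n).tangent u}
    (hproj : projDeriv u A = projDeriv u B) (hconn : connector cov u A = connector cov u B) :
    A = B := by
  have hfibre : fibreCoord u A = fibreCoord u B := by
    rw [connector, connector, hproj] at hconn
    exact add_right_cancel hconn
  rw [projDeriv, projDeriv, (hasMFDerivAt_proj u).mfderiv] at hproj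
  exact Prod.ext hproj hfibre

theorem connector_ofCoord_zero (cov : Conn n M) (u : TangentBundle (𝓡 n) M)
    (v : TangentSpace (𝓡 n) u.proj) : connector cov u (ofCoord u 0 v) = v := by
  rw [connector, projDeriv_ofCoord, map_zero, add_zero]
  rfl

/-- Compatibility of the differential of `f` with the connectors: `K' ∘ f_** = f_* ∘ K`. -/
def CommutesWithConnectors (cov : Conn n M) (cov' : Conn d M') (f : M → M') : Prop :=
  ∀ (u : TangentBundle (𝓡 n) M) (A : TangentSpace (𝓡 n).tangent u),
    connector cov' (tangentMap (𝓡 n) (𝓡 d) f u) (secondDeriv n d f u A)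
      = mfderiv (𝓡 n) (𝓡 d) f u.proj (connector cov u A)

theorem commutesWithConnectors_iff_tangentJ (hf : ContMDiff (𝓡 n) (𝓡 d) ∞ f) :
    CommutesWithConnectors cov cov' f ↔ ∀ u A, secondDeriv n d f u (tangentJ cov u A)
      = tangentJ cov' (tangentMap (𝓡 n) (𝓡 d) f u) (secondDeriv n d f u A) := by
  have hproj (u) (A : TangentSpace (𝓡 n).tangent u) :
      projDeriv (tangentMap (𝓡 n) (𝓡 d) f u) (secondDeriv n d f u (tangentJ cov u A))
        = -mfderiv (𝓡 n) (𝓡 d) f u.proj (connector cov u A) := by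
    rw [projDeriv_secondDeriv hf, projDeriv_tangentJ]
    exact map_neg (mfderiv (𝓡 n) (𝓡 d) f u.proj) _
  refine ⟨fun h u A => ext_projDeriv_connector (cov := cov') ?_ ?_, fun h u A => ?_⟩
  · rw [hproj, projDeriv_tangentJ, h]
    rfl
  · rw [h, connector_tangentJ, connector_tangentJ, projDeriv_secondDeriv hf]
  · have hJ := hproj u A
    rw [h, projDeriv_tangentJ] at hJ
    exact neg_injective hJ

theorem CommutesWithConnectors.tangentMetric_iff {S : DuallyFlat n M} {S' : DuallyFlat d M'}
    (hc : CommutesWithConnectors S.conn S'.conn f) (hf : ContMDiff (𝓡 n) (𝓡 d) ∞ f) :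
    (∀ u A B, tangentMetric S' (tangentMap (𝓡 n) (𝓡 d) f u)
      (secondDeriv n d f u A) (secondDeriv n d f u B) = tangentMetric S u A B) ↔
    ∀ (p : M) (v w : TangentSpace (𝓡 n) p),
      S'.metric.inner (f p) (mfderiv (𝓡 n) (𝓡 d) f p v) (mfderiv (𝓡 n) (𝓡 d) f p w)
        = S.metric.inner p v w := by
  have hexpand (u) (A B : TangentSpace (𝓡 n).tangent u) :
      tangentMetric S' (tangentMap (𝓡 n) (𝓡 d) f u) (secondDeriv n d f u A) (secondDeriv n d f u B)
      = S'.metric.inner (f u.proj) (mfderiv (𝓡 n) (𝓡 d) f u.proj (projDeriv u A))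
          (mfderiv (𝓡 n) (𝓡 d) f u.proj (projDeriv u B))
        + S'.metric.inner (f u.proj) (mfderiv (𝓡 n) (𝓡 d) f u.proj (connector S.conn u A))
          (mfderiv (𝓡 n) (𝓡 d) f u.proj (connector S.conn u B)) := by
    rw [tangentMetric, projDeriv_secondDeriv hf, projDeriv_secondDeriv hf, hc, hc]
    rfl
  refine ⟨fun h p v w => ?_, fun h u A B => by rw [hexpand, h, h, tangentMetric]⟩
  let u : TangentBundle (𝓡 n) M := ⟨p, 0⟩
  have hvert := (hexpand u (ofCoord u 0 v) (ofCoord u 0 w)).symm.trans (h u _ _)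
  rw [tangentMetric, connector_ofCoord_zero, connector_ofCoord_zero, projDeriv_ofCoord,
    projDeriv_ofCoord] at hvert
  simpa using hvert

end SecondDeriv

section AffineMap

variable {n d : ℕ}
  {M : Type*} [TopologicalSpace M] [ChartedSpace (RModel n) M]
  {M' : Type*} [TopologicalSpace M'] [ChartedSpace (RModel d) M']
  {X : Fin n → Π p : M, TangentSpace (𝓡 n) p} {X' : Fin d → Π p : M', TangentSpace (𝓡 d) p}
  {f : M → M'}

/-- The matrix of the differential of `f` at `q` in the frames `X` and `X'`. -/
def frameMatrix (X : Fin n → Π p : M, TangentSpace (𝓡 n) p)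
    (X' : Fin d → Π p : M', TangentSpace (𝓡 d) p) (f : M → M') (q : M) :
    RModel n →L[ℝ] RModel d :=
  coframe X' (f q) ∘L mfderiv (𝓡 n) (𝓡 d) f q ∘L frameMap X q

/-- The differential of `f` has the constant matrix `a` in the frames `X` and `X'`. -/
def HasFrameMatrix (X : Fin n → Π p : M, TangentSpace (𝓡 n) p)
    (X' : Fin d → Π p : M', TangentSpace (𝓡 d) p) (f : M → M') (a : RModel n →L[ℝ] RModel d) :
    Prop :=
  ∀ u, frameCoord X' (tangentMap (𝓡 n) (𝓡 d) f u) = a (frameCoord X u)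

theorem HasFrameMatrix.hasFDerivAt_adaptedCharts {a : RModel n →L[ℝ] RModel d}
    (ha : HasFrameMatrix X X' f a) (hf : ContMDiff (𝓡 n) (𝓡 d) ∞ f)
    {e : OpenPartialHomeomorph M (RModel n)} {e' : OpenPartialHomeomorph M' (RModel d)}
    (he : IsAdaptedChart X e) (he' : IsAdaptedChart X' e') {y : RModel n} (hy : y ∈ e.target)
    (hfy : f (e.symm y) ∈ e'.source) : HasFDerivAt (fun y => e' (f (e.symm y))) a y := by
  have hsymm := (mdifferentiable_of_mem_maximalAtlas he.1).mdifferentiableAt_symm hy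
  refine ((he'.hasMFDerivAt hfy).comp y ((hf.mdifferentiable (by simp) _).hasMFDerivAt.comp y
    hsymm.hasMFDerivAt)).congr_mfderiv ?_ |>.hasFDerivAt
  ext1 w
  have hw : coframe X (e.symm y) (mfderiv 𝓘(ℝ, RModel n) (𝓡 n) e.symm y w) = w := by
    rw [← he.2 _ (e.map_target hy)]
    exact congrArg (fun T => T w) ((mdifferentiable_of_mem_maximalAtlas he.1).comp_symm_deriv hy)
  exact (ha ⟨e.symm y, mfderiv 𝓘(ℝ, RModel n) (𝓡 n) e.symm y w⟩).trans (congrArg a hw)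

variable [IsManifold (𝓡 n) ∞ M]

theorem exists_hasFrameMatrix [ConnectedSpace M] (hX : IsFrame X)
    (hconst : ∀ c p, ∀ᶠ q in 𝓝 p, frameMatrix X X' f q c = frameMatrix X X' f p c) :
    ∃ a, HasFrameMatrix X X' f a := by
  obtain ⟨p₀⟩ : Nonempty M := inferInstance
  refine ⟨frameMatrix X X' f p₀, fun u => ?_⟩
  have hloc : IsLocallyConstant fun q => frameMatrix X X' f q (frameCoord X u) :=
    (IsLocallyConstant.iff_eventually_eq _).2 (hconst _)
  rw [← hloc.apply_eq_of_preconnectedSpace u.proj p₀]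
  exact congrArg (fun v => coframe X' (f u.proj) (mfderiv (𝓡 n) (𝓡 d) f u.proj v))
    (hX.frameMap_coframe u.proj u.2).symm

variable [IsManifold (𝓡 d) ∞ M'] {cov : Conn n M} {cov' : Conn d M'}

theorem IsParallelFrame.mvfderiv_frameCoord_tangentMap (hX' : IsParallelFrame cov' X')
    (hf : ContMDiff (𝓡 n) (𝓡 d) ∞ f) (u : TangentBundle (𝓡 n) M)
    (A : TangentSpace (𝓡 n).tangent u) :
    mvfderiv (𝓡 n).tangent (frameCoord X' ∘ tangentMap (𝓡 n) (𝓡 d) f) u A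
      = coframe X' (f u.proj)
        (connector cov' (tangentMap (𝓡 n) (𝓡 d) f u) (secondDeriv n d f u A)) :=
  (mfderiv_comp_apply u (hX'.contMDiff_frameCoord.mdifferentiable (by simp) _)
    (mdifferentiable_tangentMap hf u) A).trans (hX'.mvfderiv_frameCoord _ _)

theorem HasFrameMatrix.commutesWithConnectors {a : RModel n →L[ℝ] RModel d}
    (ha : HasFrameMatrix X X' f a) (hX : IsParallelFrame cov X) (hX' : IsParallelFrame cov' X')
    (hf : ContMDiff (𝓡 n) (𝓡 d) ∞ f) : CommutesWithConnectors cov cov' f := by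
  intro u A
  have hcomp : mvfderiv (𝓡 n).tangent (a ∘ frameCoord X) u A
      = a (mvfderiv (𝓡 n).tangent (frameCoord X) u A) :=
    congrArg (fun T => T A) (a.hasMFDerivAt.comp u
      (hX.contMDiff_frameCoord.mdifferentiable (by simp) u).hasMFDerivAt).mfderiv
  apply hX'.coframe_injective
  refine (hX'.mvfderiv_frameCoord_tangentMap hf u A).symm.trans ?_
  rw [show frameCoord X' ∘ tangentMap (𝓡 n) (𝓡 d) f = a ∘ frameCoord X from funext ha, hcomp,
    hX.mvfderiv_frameCoord]
  exact (ha ⟨u.proj, connector cov u A⟩).symm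

theorem IsParallelFrame.connector_mfderiv_frameMap (hX : IsParallelFrame cov X) (c : RModel n)
    (q : M) (v : TangentSpace (𝓡 n) q) :
    connector cov ⟨q, frameMap X q c⟩ (mfderiv (𝓡 n) (𝓡 n).tangent
      (fun q => (⟨q, frameMap X q c⟩ : TangentBundle (𝓡 n) M)) q v) = 0 := by
  apply hX.coframe_injective
  rw [← hX.mvfderiv_frameCoord]
  have hconst : frameCoord X ∘ (fun q => (⟨q, frameMap X q c⟩ : TangentBundle (𝓡 n) M))
      = fun _ => c := funext fun q => hX.coframe_frameMap q c
  have hcomp := mfderiv_comp_apply q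
    (hX.contMDiff_frameCoord.mdifferentiable (by simp) ⟨q, frameMap X q c⟩)
    (hX.isDiffFieldAt_frameMap c q) v
  rw [hconst, mfderiv_const] at hcomp
  exact hcomp.symm.trans (map_zero (coframe X q)).symm

theorem CommutesWithConnectors.frameMatrix_eventually_eq (hc : CommutesWithConnectors cov cov' f)
    (hX : IsParallelFrame cov X) (hX' : IsParallelFrame cov' X')
    (hf : ContMDiff (𝓡 n) (𝓡 d) ∞ f) (c : RModel n) (p : M) :
    ∀ᶠ q in 𝓝 p, frameMatrix X X' f q c = frameMatrix X X' f p c := by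
  refine eventually_eq_of_mfderiv_eq_zero (I := 𝓡 n) (Filter.Eventually.of_forall fun q => ?_)
  have hcoord : MDifferentiable (𝓡 n).tangent 𝓘(ℝ, RModel d)
      (frameCoord X' ∘ tangentMap (𝓡 n) (𝓡 d) f) :=
    (hX'.contMDiff_frameCoord.mdifferentiable (by simp)).comp (mdifferentiable_tangentMap hf)
  refine ((hcoord ⟨q, frameMap X q c⟩).hasMFDerivAt.comp q
    (hX.isDiffFieldAt_frameMap c q).hasMFDerivAt).congr_mfderiv ?_
  ext1 v
  have hzero := hX'.mvfderiv_frameCoord_tangentMap hf ⟨q, frameMap X q c⟩ (mfderiv (𝓡 n)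
    (𝓡 n).tangent (fun q => (⟨q, frameMap X q c⟩ : TangentBundle (𝓡 n) M)) q v)
  rw [hc, hX.connector_mfderiv_frameMap, map_zero] at hzero
  exact hzero.trans (map_zero (coframe X' (f q)))

theorem IsParallelFrame.coframe_coordField_eventually_eq (hX : IsParallelFrame cov X)
    {e : OpenPartialHomeomorph M (RModel n)} (he : IsAffineChart cov e) (v : RModel n) {p : M}
    (hp : p ∈ e.source) :
    ∀ᶠ q in 𝓝 p, coframe X q (coordField e v q) = coframe X p (coordField e v p) := by
  refine eventually_eq_of_mfderiv_eq_zero (I := 𝓡 n)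
    (g := fun q => coframe X q (coordField e v q)) ?_
  filter_upwards [e.open_source.mem_nhds hp] with q hq
  have hdiff := isDiffFieldAt_coordField he.1 v hq
  refine (hX.mdifferentiableAt_coframe hdiff).hasMFDerivAt.congr_mfderiv ?_
  ext1 a
  refine (hX.coframe_cov hdiff a).symm.trans ?_
  have hparallel := he.2 (mfderiv (𝓡 n) (𝓡 n) e q a) v q hq
  rw [coordField_mfderiv he.1 hq] at hparallel
  rw [hparallel, map_zero]
  rfl

theorem IsParallelFrame.frameMap_eventually_eq_coordField (hX : IsParallelFrame cov X)
    {e : OpenPartialHomeomorph M (RModel n)} (he : IsAffineChart cov e) (c : RModel n) {p : M}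
    (hp : p ∈ e.source) :
    ∀ᶠ q in 𝓝 p, frameMap X q c = coordField e (mfderiv (𝓡 n) (𝓡 n) e p (frameMap X p c)) q := by
  filter_upwards [hX.coframe_coordField_eventually_eq he
    (mfderiv (𝓡 n) (𝓡 n) e p (frameMap X p c)) hp] with q hq
  apply hX.coframe_injective
  rw [hq, coordField_mfderiv he.1 hp, hX.coframe_frameMap, hX.coframe_frameMap]

theorem IsAffineMap.frameMatrix_eventually_eq (haff : IsAffineMap cov cov' f)
    (hX : IsParallelFrame cov X) (hX' : IsParallelFrame cov' X')
    (hf : ContMDiff (𝓡 n) (𝓡 d) ∞ f) (c : RModel n) (p : M) :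
    ∀ᶠ q in 𝓝 p, frameMatrix X X' f q c = frameMatrix X X' f p c := by
  obtain ⟨e, e', he, he', hp, hsub, A, hA⟩ := haff p
  have hfe (q) (hq : q ∈ e.source) : f q ∈ e'.source := hsub ⟨q, hq, rfl⟩
  set v : RModel n := mfderiv (𝓡 n) (𝓡 n) e p (frameMap X p c)
  set A' : RModel n →L[ℝ] RModel d := LinearMap.toContinuousLinearMap A.linear
  have hA' (y : RModel n) : HasFDerivAt A A' y := by
    have hdecomp : (A : RModel n → RModel d) = fun y => A' y + A 0 := A.decomp
    rw [hdecomp]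
    exact A'.hasFDerivAt.add_const _
  have hpush (q) (hq : q ∈ e.source) :
      mfderiv (𝓡 n) (𝓡 d) f q (coordField e v q) = coordField e' (A' v) (f q) := by
    refine mfderiv_apply_coordField he.1 he'.1 hq (hfe q hq) (hf.mdifferentiable (by simp) q)
      (hA' _) ?_ v
    filter_upwards [e.open_source.mem_nhds hq] with z hz
    simpa only [Function.comp_apply, e.left_inv hz] using hA (e z) (e.map_source hz)
  have hconst : ∀ᶠ q in 𝓝 p, frameMatrix X X' f q c
      = coframe X' (f p) (coordField e' (A' v) (f p)) := by
    filter_upwards [e.open_source.mem_nhds hp, hX.frameMap_eventually_eq_coordField he c hp,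
      (hf.continuous.tendsto p).eventually
        (hX'.coframe_coordField_eventually_eq he' (A' v) (hfe p hp))] with q hq hframe hcoord
    rw [frameMatrix, ContinuousLinearMap.comp_apply, ContinuousLinearMap.comp_apply, hframe,
      hpush q hq, hcoord]
  filter_upwards [hconst] with q hq
  rw [hq, hconst.self_of_nhds]

theorem HasFrameMatrix.isAffineMap {a : RModel n →L[ℝ] RModel d} (ha : HasFrameMatrix X X' f a)
    (hX : IsParallelFrame cov X) (hX' : IsParallelFrame cov' X')
    (htor : ∀ p, cov.torsion p = 0) (htor' : ∀ p, cov'.torsion p = 0)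
    (hf : ContMDiff (𝓡 n) (𝓡 d) ∞ f) : IsAffineMap cov cov' f := by
  intro p
  obtain ⟨e', he', hp'⟩ := hX'.exists_isAdaptedChart htor' (f p)
  obtain ⟨e, he, hp, hsub, hconn⟩ := hX.exists_small_isAdaptedChart htor
    (hf.continuous.continuousAt.preimage_mem_nhds (e'.open_source.mem_nhds hp'))
  refine ⟨e, e', he.isAffineChart hX, he'.isAffineChart hX', hp, Set.image_subset_iff.2 hsub,
    (a : RModel n →ₗ[ℝ] RModel d).toAffineMap
      + AffineMap.const ℝ (RModel n) (e' (f (e.symm (e p))) - a (e p)), fun y hy => ?_⟩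
  have hderiv (y) (hy : y ∈ e.target) :=
    ha.hasFDerivAt_adaptedCharts hf he he' hy (hsub (e.map_target hy))
  refine e.open_target.eqOn_of_fderiv_eq hconn
    (fun y hy => (hderiv y hy).differentiableAt.differentiableWithinAt)
    (g := fun y => a y + (e' (f (e.symm (e p))) - a (e p)))
    (a.differentiable.add_const _).differentiableOn (fun y hy => ?_) (e.map_source hp) ?_ hy
  · rw [(hderiv y hy).fderiv, (a.hasFDerivAt.add_const _).fderiv]
  · exact (add_sub_cancel _ _).symm

theorem commutesWithConnectors_iff_exists_hasFrameMatrix [ConnectedSpace M]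
    (hX : IsParallelFrame cov X) (hX' : IsParallelFrame cov' X')
    (hf : ContMDiff (𝓡 n) (𝓡 d) ∞ f) :
    CommutesWithConnectors cov cov' f ↔ ∃ a, HasFrameMatrix X X' f a :=
  ⟨fun hc => exists_hasFrameMatrix hX.toIsFrame (hc.frameMatrix_eventually_eq hX hX' hf),
    fun ⟨_, ha⟩ => ha.commutesWithConnectors hX hX' hf⟩

theorem isAffineMap_iff_exists_hasFrameMatrix [ConnectedSpace M]
    (hX : IsParallelFrame cov X) (hX' : IsParallelFrame cov' X')
    (htor : ∀ p, cov.torsion p = 0) (htor' : ∀ p, cov'.torsion p = 0)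
    (hf : ContMDiff (𝓡 n) (𝓡 d) ∞ f) :
    IsAffineMap cov cov' f ↔ ∃ a, HasFrameMatrix X X' f a :=
  ⟨fun haff => exists_hasFrameMatrix hX.toIsFrame (haff.frameMatrix_eventually_eq hX hX' hf),
    fun ⟨_, ha⟩ => ha.isAffineMap hX hX' htor htor' hf⟩

end AffineMap

section Torus

open scoped Matrix

theorem exists_isOfFinAddOrder_mem_addCircle {r : ℝ} [hr : Fact (0 < r)]
    {H : AddSubgroup (AddCircle r)} (hH : IsClosed (H : Set (AddCircle r))) (hne : H ≠ ⊥) :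
    ∃ a ∈ H, a ≠ 0 ∧ IsOfFinAddOrder a := by
  by_cases hdense : Dense (H : Set (AddCircle r))
  · have htwo : addOrderOf ((r / (2 : ℕ) : ℝ) : AddCircle r) = 2 :=
      AddCircle.addOrderOf_period_div two_pos
    refine ⟨_, ?_, ?_, addOrderOf_pos_iff.1 (htwo ▸ two_pos)⟩
    · rw [← SetLike.mem_coe, ← hH.closure_eq]
      exact hdense _
    · rw [Ne, ← AddMonoid.addOrderOf_eq_one_iff, htwo]
      exact OfNat.ofNat_ne_one 2
  · rw [AddCircle.dense_addSubgroup_iff_ne_zmultiples] at hdense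
    push Not at hdense
    obtain ⟨a, ha, rfl⟩ := hdense
    exact ⟨a, AddSubgroup.mem_zmultiples a, fun h => hne (AddSubgroup.zmultiples_eq_bot.2 h),
      addOrderOf_ne_zero_iff.1 ha⟩

theorem exists_isOfFinAddOrder_mem_of_inf_ker_eq_bot {A B : Type*} [AddGroup A] [AddGroup B]
    {H : AddSubgroup A} {φ : A →+ B} (hker : H ⊓ φ.ker = ⊥)
    (hmap : ∃ b ∈ H.map φ, b ≠ 0 ∧ IsOfFinAddOrder b) : ∃ a ∈ H, a ≠ 0 ∧ IsOfFinAddOrder a := by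
  obtain ⟨_, ⟨a, ha, rfl⟩, hne, hfin⟩ := hmap
  refine ⟨a, ha, fun h => hne (by rw [h, map_zero]), ?_⟩
  rw [isOfFinAddOrder_iff_nsmul_eq_zero] at hfin ⊢
  obtain ⟨k, hk, hka⟩ := hfin
  refine ⟨k, hk, (AddSubgroup.eq_bot_iff_forall _).1 hker _ ⟨H.nsmul_mem ha k, ?_⟩⟩
  exact φ.mem_ker.2 ((map_nsmul φ k a).trans hka)

theorem exists_isOfFinAddOrder_mem_torus {n : ℕ} {H : AddSubgroup (Torus n)}
    (hH : IsClosed (H : Set (Torus n))) (hne : H ≠ ⊥) : ∃ a ∈ H, a ≠ 0 ∧ IsOfFinAddOrder a := by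
  suffices h : ∀ (s : Finset (Fin n)) (H : AddSubgroup (Torus n)), IsClosed (H : Set (Torus n)) →
      H ≠ ⊥ → (∀ a ∈ H, ∀ i ∉ s, a i = 0) → ∃ a ∈ H, a ≠ 0 ∧ IsOfFinAddOrder a from
    h Finset.univ H hH hne fun _ _ i hi => absurd (Finset.mem_univ i) hi
  intro s
  induction s using Finset.induction_on with
  | empty =>
    exact fun H _ hne hs =>
      absurd (H.eq_bot_iff_forall.2 fun a ha => funext fun i => hs a ha i (Finset.notMem_empty i))
        hne
  | insert i s _ ih =>
    intro H hH hne hs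
    let φ : Torus n →+ UnitAddCircle := Pi.evalAddMonoidHom (fun _ => UnitAddCircle) i
    have hφ : Continuous φ := continuous_apply i
    by_cases hker : H ⊓ φ.ker = ⊥
    · refine exists_isOfFinAddOrder_mem_of_inf_ker_eq_bot hker
        (exists_isOfFinAddOrder_mem_addCircle (hH.isCompact.image hφ).isClosed fun hbot => hne ?_)
      rw [← hker, left_eq_inf]
      exact (AddSubgroup.map_eq_bot_iff H).1 hbot
    · obtain ⟨a, ha, hfin⟩ := ih (H ⊓ φ.ker) (hH.inter (isClosed_singleton.preimage hφ)) hker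
        fun a ha j hj => by
          by_cases hji : j = i
          · exact hji ▸ ha.2
          · exact hs a ha.1 j (by simp [hji, hj])
      exact ⟨a, ha.1, hfin⟩

theorem finite_nsmul_eq_zero_torus (n : ℕ) {k : ℕ} (hk : 0 < k) :
    {a : Torus n | k • a = 0}.Finite :=
  (Set.Finite.pi' fun _ => AddCircle.finite_torsion (p := (1 : ℝ)) hk).subset
    fun _ ha i => congrFun ha i

theorem countable_isOfFinAddOrder_torus (n : ℕ) :
    {a : Torus n | IsOfFinAddOrder a}.Countable := by
  refine (Set.countable_iUnion fun k : ℕ =>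
    (finite_nsmul_eq_zero_torus n k.succ_pos).countable).mono fun a ha => ?_
  obtain ⟨k, hk, hka⟩ := isOfFinAddOrder_iff_nsmul_eq_zero.1 ha
  exact Set.mem_iUnion.2 ⟨k - 1, by rwa [Set.mem_ofPred_eq, Nat.succ_eq_add_one,
    Nat.sub_add_cancel hk]⟩

theorem isOpenQuotientMap_torusMk (n : ℕ) : IsOpenQuotientMap (Torus.mk : (Fin n → ℝ) → Torus n) :=
  IsOpenQuotientMap.piMap fun _ => QuotientAddGroup.isOpenQuotientMap_mk

/-- The homomorphism of tori induced by an integral matrix. -/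
def torusHom {n d : ℕ} (a : Matrix (Fin d) (Fin n) ℤ) : Torus n →+ Torus d where
  toFun x j := ∑ i, a j i • x i
  map_zero' := by
    ext j
    simp
  map_add' x y := by
    ext j
    simp [Finset.sum_add_distrib]

theorem torusHom_apply {n d : ℕ} (a : Matrix (Fin d) (Fin n) ℤ) (x : Torus n) (j : Fin d) :
    torusHom a x j = ∑ i, a j i • x i :=
  rfl

theorem torusHom_mk {n d : ℕ} (a : Matrix (Fin d) (Fin n) ℤ) (t : Fin n → ℝ) :
    torusHom a (Torus.mk t) = Torus.mk (a.map (Int.cast : ℤ → ℝ) *ᵥ t) := by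
  ext j
  simp only [torusHom_apply, Torus.mk, Matrix.mulVec, dotProduct, Matrix.map_apply,
    ← zsmul_eq_mul]
  exact (map_sum (QuotientAddGroup.mk' (AddSubgroup.zmultiples (1 : ℝ)))
    (fun i => a j i • t i) Finset.univ).symm

theorem isLieHom_torusHom {n d : ℕ} (a : Matrix (Fin d) (Fin n) ℤ) : IsLieHom (torusHom a) where
  smooth j := by
    have hexp : (fun t : Fin n → ℝ => (torusHom a (Torus.mk t) j).toCircle)
        = fun t => Circle.exp (2 * Real.pi / 1 * ∑ i, (a j i : ℝ) * t i) := by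
      funext t
      rw [torusHom_mk]
      exact AddCircle.toCircle_apply_mk _
    rw [hexp]
    exact contMDiff_circleExp.comp (ContDiff.contMDiff (by fun_prop))

theorem torusHom_torusHom {n d e : ℕ} (b : Matrix (Fin e) (Fin d) ℤ) (a : Matrix (Fin d) (Fin n) ℤ)
    (x : Torus n) : torusHom b (torusHom a x) = torusHom (b * a) x := by
  ext k
  simp only [torusHom_apply, Matrix.mul_apply, Finset.smul_sum, Finset.sum_smul, mul_smul]
  rw [Finset.sum_comm]

theorem torusHom_smul_one {n : ℕ} (k : ℤ) (x : Torus n) :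
    torusHom (k • (1 : Matrix (Fin n) (Fin n) ℤ)) x = k • x := by
  ext j
  have hcoeff (i : Fin n) : (k • (1 : Matrix (Fin n) (Fin n) ℤ)) j i = if j = i then k else 0 := by
    rw [Matrix.smul_apply, Matrix.one_apply, smul_ite, smul_zero, zsmul_one, Int.cast_id]
  simp only [torusHom_apply, hcoeff, ite_smul, zero_smul, Finset.sum_ite_eq, Finset.mem_univ,
    if_true]
  rfl

theorem finite_ker_torusHom {n d : ℕ} {a : Matrix (Fin d) (Fin n) ℤ}
    (ha : Function.Injective (a.map (Int.cast : ℤ → ℝ)).mulVec) :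
    ((torusHom a).ker : Set (Torus n)).Finite := by
  have hdet : (aᵀ * a).det ≠ 0 := by
    have hpos := (Matrix.PosDef.conjTranspose_mul_self _ ha).det_pos
    have hmap : (a.map (Int.cast : ℤ → ℝ))ᴴ * a.map (Int.cast : ℤ → ℝ)
        = (Int.castRingHom ℝ).mapMatrix (aᵀ * a) := by
      rw [RingHom.mapMatrix_apply, Matrix.map_mul, Matrix.conjTranspose_eq_transpose_of_trivial]
      rfl
    rw [hmap, ← RingHom.map_det] at hpos
    exact fun h => hpos.ne' (by rw [h, map_zero])
  -- Cramer's rule: `adj(aᵀa) aᵀ` is a left inverse of `a` up to the factor `det(aᵀa)`.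
  refine (finite_nsmul_eq_zero_torus n (Int.natAbs_pos.2 hdet)).subset fun x hx => ?_
  have hsmul : (aᵀ * a).det • x = 0 := by
    rw [← torusHom_smul_one, ← Matrix.adjugate_mul, ← torusHom_torusHom, ← torusHom_torusHom,
      (torusHom a).mem_ker.1 hx, map_zero, map_zero]
  exact (natAbs_nsmul_eq_zero).2 hsmul

end Torus

section Holomorphy

section ComplexLinear

variable {E F : Type*} [NormedAddCommGroup E] [NormedSpace ℂ E] [NormedAddCommGroup F]
  [NormedSpace ℂ F] {g g₁ g₂ : E → F} {c y y₀ : E} {r : ℝ}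

theorem differentiableAt_complex_iff_fderiv_I_smul (hg : DifferentiableAt ℝ g y) :
    DifferentiableAt ℂ g y ↔
      ∀ w, fderiv ℝ g y (Complex.I • w) = Complex.I • fderiv ℝ g y w := by
  rw [differentiableAt_iff_restrictScalars ℝ hg]
  constructor
  · rintro ⟨D, hD⟩ w
    rw [← hD]
    exact D.map_smul Complex.I w
  · intro h
    refine ⟨{ fderiv ℝ g y with map_smul' := fun z w => ?_ }, rfl⟩
    calc fderiv ℝ g y (z • w)
        = fderiv ℝ g y (z.re • w + z.im • Complex.I • w) := by
          congr 1
          conv_lhs => rw [← Complex.re_add_im z, add_smul, mul_smul]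
          rfl
      _ = z.re • fderiv ℝ g y w + z.im • Complex.I • fderiv ℝ g y w := by
          rw [map_add, map_smul, map_smul, h]
      _ = z • fderiv ℝ g y w := by
          conv_rhs => rw [← Complex.re_add_im z, add_smul, mul_smul]
          rfl

theorem differentiableAt_complex_of_frequently (hg : ContDiffAt ℝ 1 g y)
    (h : ∃ᶠ z in 𝓝 y, DifferentiableAt ℂ g z) : DifferentiableAt ℂ g y := by
  rw [differentiableAt_complex_iff_fderiv_I_smul (hg.differentiableAt one_ne_zero)]
  intro w
  have hD : ContinuousAt (fderiv ℝ g) y :=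
    (hg.fderiv_right (m := 0) (by simp)).continuousAt
  have hcont : ContinuousAt
      (fun z => fderiv ℝ g z (Complex.I • w) - Complex.I • fderiv ℝ g z w) y :=
    (hD.clm_apply continuousAt_const).sub ((hD.clm_apply continuousAt_const).const_smul _)
  refine sub_eq_zero.1 (isClosed_singleton.mem_of_frequently_of_tendsto
    (h.mono fun z hz => ?_) hcont)
  exact sub_eq_zero.2 ((differentiableAt_complex_iff_fderiv_I_smul (hz.restrictScalars ℝ)).1 hz w)

theorem eqOn_ball_of_eventuallyEq [CompleteSpace F] (h₁ : DifferentiableOn ℂ g₁ (Metric.ball c r))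
    (h₂ : DifferentiableOn ℂ g₂ (Metric.ball c r)) (hy₀ : y₀ ∈ Metric.ball c r)
    (h : g₁ =ᶠ[𝓝 y₀] g₂) : Set.EqOn g₁ g₂ (Metric.ball c r) := by
  -- One complex variable suffices: restrict to the complex line through `y₀` and `y`.
  intro y hy
  let ℓ : ℂ → E := fun z => z • (y - y₀) + y₀
  have hℓ : Differentiable ℂ ℓ := by fun_prop
  have hopen : IsOpen (ℓ ⁻¹' Metric.ball c r) := Metric.isOpen_ball.preimage hℓ.continuous
  have hconv : Convex ℝ (ℓ ⁻¹' Metric.ball c r) :=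
    ((convex_ball c r).translate_preimage_left y₀).linear_preimage
      ((LinearMap.toSpanSingleton ℂ E (y - y₀)).restrictScalars ℝ)
  have hana {g : E → F} (hg : DifferentiableOn ℂ g (Metric.ball c r)) :
      AnalyticOnNhd ℂ (g ∘ ℓ) (ℓ ⁻¹' Metric.ball c r) :=
    (hg.comp hℓ.differentiableOn (Set.mapsTo_preimage _ _)).analyticOnNhd hopen
  have hzero : ℓ 0 = y₀ := by simp [ℓ]
  have hone : ℓ 1 = y := by simp [ℓ]
  have hnear : g₁ ∘ ℓ =ᶠ[𝓝 0] g₂ ∘ ℓ :=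
    (hzero ▸ hℓ.continuous.continuousAt (x := 0) : Filter.Tendsto ℓ (𝓝 0) (𝓝 y₀)).eventually h
  have heq := (hana h₁).eqOn_of_preconnected_of_eventuallyEq (hana h₂) hconv.isPreconnected
    (by rwa [Set.mem_preimage, hzero]) hnear (x := 1) (by rwa [Set.mem_preimage, hone])
  rwa [Function.comp_apply, Function.comp_apply, hone] at heq

end ComplexLinear

section Manifold

variable {E F : Type*} [NormedAddCommGroup E] [NormedSpace ℂ E] [NormedAddCommGroup F]
  [NormedSpace ℂ F] {N : Type*} [TopologicalSpace N] [ChartedSpace E N] {N' : Type*}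
  [TopologicalSpace N'] [ChartedSpace F N'] {m m₁ m₂ : N → N'} {p : N}

theorem mdifferentiableAt_iff_differentiableAt_chart [IsManifold 𝓘(ℂ, E) 1 N]
    [IsManifold 𝓘(ℂ, F) 1 N'] {q : N} {q' : N'} (hp : p ∈ (chartAt E q).source)
    (hm : ContinuousAt m p) (hp' : m p ∈ (chartAt F q').source) :
    MDifferentiableAt 𝓘(ℂ, E) 𝓘(ℂ, F) m p ↔
      DifferentiableAt ℂ (chartAt F q' ∘ m ∘ (chartAt E q).symm) (chartAt E q p) := by
  rw [mdifferentiableAt_iff_of_mem_source hp hp', and_iff_right hm]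
  simp only [mfld_simps, differentiableWithinAt_univ]

theorem eventuallyEq_of_frequently_eventuallyEq [CompleteSpace F] [T2Space N']
    [IsManifold 𝓘(ℂ, E) 1 N] [IsManifold 𝓘(ℂ, F) 1 N'] (h₁ : MDifferentiable 𝓘(ℂ, E) 𝓘(ℂ, F) m₁)
    (h₂ : MDifferentiable 𝓘(ℂ, E) 𝓘(ℂ, F) m₂) (h : ∃ᶠ q in 𝓝 p, m₁ =ᶠ[𝓝 q] m₂) :
    m₁ =ᶠ[𝓝 p] m₂ := by
  have hmp : m₁ p = m₂ p := tendsto_nhds_unique_of_frequently_eq h₁.continuous.continuousAt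
    h₂.continuous.continuousAt (h.mono fun q hq => hq.self_of_nhds)
  let φ := chartAt E p
  let ψ := chartAt F (m₁ p)
  have hp : p ∈ φ.source := mem_chart_source E p
  have hψ : ψ.source ∈ 𝓝 (m₁ p) := chart_source_mem_nhds F (m₁ p)
  obtain ⟨r, hr, hball⟩ : ∃ r > 0, ∀ y ∈ Metric.ball (φ p) r,
      y ∈ φ.target ∧ m₁ (φ.symm y) ∈ ψ.source ∧ m₂ (φ.symm y) ∈ ψ.source := by
    refine Metric.eventually_nhds_iff_ball.1
      ((φ.open_target.eventually_mem (φ.map_source hp)).and ?_)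
    exact (φ.eventually_nhds' (fun x => m₁ x ∈ ψ.source ∧ m₂ x ∈ ψ.source) hp).2
      ((h₁.continuous.continuousAt.eventually_mem hψ).and
        (h₂.continuous.continuousAt.eventually_mem (hmp ▸ hψ)))
  have hdiff {m : N → N'} (hm : MDifferentiable 𝓘(ℂ, E) 𝓘(ℂ, F) m)
      (hmψ : ∀ y ∈ Metric.ball (φ p) r, m (φ.symm y) ∈ ψ.source) :
      DifferentiableOn ℂ (ψ ∘ m ∘ φ.symm) (Metric.ball (φ p) r) := fun y hy => by
    have hy' := (mdifferentiableAt_iff_differentiableAt_chart (φ.map_target (hball y hy).1)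
      hm.continuous.continuousAt (hmψ y hy)).1 (hm _)
    rw [φ.right_inv (hball y hy).1] at hy'
    exact hy'.differentiableWithinAt
  have hnear : ∀ᶠ q in 𝓝 p, q ∈ φ.source ∧ φ q ∈ Metric.ball (φ p) r :=
    (φ.open_source.eventually_mem hp).and (φ.continuousAt hp (Metric.ball_mem_nhds _ hr))
  obtain ⟨q, hq, hqφ, hqr⟩ := (h.and_eventually hnear).exists
  have heqOn := eqOn_ball_of_eventuallyEq (hdiff h₁ fun y hy => (hball y hy).2.1)
    (hdiff h₂ fun y hy => (hball y hy).2.2) hqr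
    (((φ.eventually_nhds' (fun x => m₁ x = m₂ x) hqφ).2 hq).mono fun _ => congrArg ψ)
  refine (φ.eventually_nhds' (fun x => m₁ x = m₂ x) hp).1 ?_
  filter_upwards [Metric.ball_mem_nhds (φ p) hr] with y hy
  exact ψ.injOn (hball y hy).2.1 (hball y hy).2.2 (heqOn hy)

theorem eq_of_mdifferentiable_of_eventuallyEq [CompleteSpace F] [PreconnectedSpace N] [T2Space N']
    [IsManifold 𝓘(ℂ, E) 1 N] [IsManifold 𝓘(ℂ, F) 1 N'] (h₁ : MDifferentiable 𝓘(ℂ, E) 𝓘(ℂ, F) m₁)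
    (h₂ : MDifferentiable 𝓘(ℂ, E) 𝓘(ℂ, F) m₂) (h : m₁ =ᶠ[𝓝 p] m₂) : m₁ = m₂ := by
  have hclopen : IsClopen {q | m₁ =ᶠ[𝓝 q] m₂} :=
    ⟨isClosed_iff_frequently.2 fun _ => eventuallyEq_of_frequently_eventuallyEq h₁ h₂,
      isOpen_setOfPred_eventually_nhds⟩
  have huniv := hclopen.eq_univ ⟨p, h⟩
  exact funext fun q => (huniv.ge (Set.mem_univ q) : m₁ =ᶠ[𝓝 q] m₂).self_of_nhds

end Manifold

section CModel

variable {n d : ℕ} {N : Type*} [TopologicalSpace N] [ChartedSpace (CModel n) N]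
  {N' : Type*} [TopologicalSpace N'] [ChartedSpace (CModel d) N'] {m : N → N'} {p : N}

theorem mdifferentiableAt_complex_iff
    (hm : MDifferentiableAt 𝓘(ℝ, CModel n) 𝓘(ℝ, CModel d) m p) :
    MDifferentiableAt 𝓘(ℂ, CModel n) 𝓘(ℂ, CModel d) m p ↔
      ∀ v, mfderiv 𝓘(ℝ, CModel n) 𝓘(ℝ, CModel d) m p (complexJ p v)
        = complexJ (m p) (mfderiv 𝓘(ℝ, CModel n) 𝓘(ℝ, CModel d) m p v) := by
  have hfderiv := hm.mfderiv
  have hdiff := ((mdifferentiableAt_iff m p).1 hm).2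
  rw [mdifferentiableAt_iff, and_iff_right hm.continuousAt]
  simp only [mfld_simps, differentiableWithinAt_univ, fderivWithin_univ] at hfderiv hdiff ⊢
  rw [differentiableAt_complex_iff_fderiv_I_smul hdiff, hfderiv]
  rfl

theorem isHolomorphic_iff_mdifferentiable
    (hm : MDifferentiable 𝓘(ℝ, CModel n) 𝓘(ℝ, CModel d) m) :
    IsHolomorphic n d m ↔ MDifferentiable 𝓘(ℂ, CModel n) 𝓘(ℂ, CModel d) m :=
  forall_congr' fun p => (mdifferentiableAt_complex_iff (hm p)).symm

theorem isHolomorphic_of_dense [IsManifold 𝓘(ℂ, CModel n) ω N] [IsManifold 𝓘(ℂ, CModel d) ω N']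
    (hm : ContMDiff 𝓘(ℝ, CModel n) 𝓘(ℝ, CModel d) 1 m) {s : Set N}
    (hs : Dense s) (h : ∀ p ∈ s, ∀ v, mfderiv 𝓘(ℝ, CModel n) 𝓘(ℝ, CModel d) m p (complexJ p v)
      = complexJ (m p) (mfderiv 𝓘(ℝ, CModel n) 𝓘(ℝ, CModel d) m p v)) :
    IsHolomorphic n d m := by
  have hdiff := hm.mdifferentiable one_ne_zero
  refine (isHolomorphic_iff_mdifferentiable hdiff).2 fun p => ?_
  let φ := chartAt (CModel n) p
  let ψ := chartAt (CModel d) (m p)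
  have hp : p ∈ φ.source := mem_chart_source (CModel n) p
  have hψ : ψ.source ∈ 𝓝 (m p) := chart_source_mem_nhds (CModel d) (m p)
  rw [mdifferentiableAt_iff_differentiableAt_chart hp hm.continuous.continuousAt
    (mem_of_mem_nhds hψ)]
  have hsmooth : ContDiffAt ℝ 1 (ψ ∘ m ∘ φ.symm) (φ p) := by
    have h := (contMDiffAt_iff.1 (hm.contMDiffAt (x := p))).2
    simpa only [mfld_simps, contDiffWithinAt_univ] using h
  have hnear : ∀ᶠ q in 𝓝 p, q ∈ φ.source ∧ m q ∈ ψ.source :=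
    (φ.open_source.eventually_mem hp).and (hm.continuous.continuousAt.eventually_mem hψ)
  refine differentiableAt_complex_of_frequently hsmooth ((φ.continuousAt hp).frequently ?_)
  refine ((mem_closure_iff_frequently.1 (hs p)).and_eventually hnear).mono ?_
  rintro q ⟨hqs, hqφ, hqψ⟩
  exact (mdifferentiableAt_iff_differentiableAt_chart hqφ hm.continuous.continuousAt hqψ).1
    ((mdifferentiableAt_complex_iff (hdiff q)).2 (h q hqs))

variable [IsManifold 𝓘(ℂ, CModel n) ω N] [IsManifold 𝓘(ℂ, CModel d) ω N']

theorem Kahler.continuousAt_inner (G : Kahler n N) {B : Type*} [TopologicalSpace B] {x : B}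
    {b : B → N} {V W : Π y : B, TangentSpace 𝓘(ℝ, CModel n) (b y)} (hb : ContinuousAt b x)
    (hV : ContinuousAt (fun y => (⟨b y, V y⟩ : TangentBundle 𝓘(ℝ, CModel n) N)) x)
    (hW : ContinuousAt (fun y => (⟨b y, W y⟩ : TangentBundle 𝓘(ℝ, CModel n) N)) x) :
    ContinuousAt (fun y => G.metric.inner (b y) (V y) (W y)) x := by
  have h := ContinuousAt.clm_bundle_apply₂ (b := b) (F₁ := CModel n) (F₂ := CModel n)
    (F₃ := ℝ) (E₃ := Bundle.Trivial N ℝ) (ψ := fun y => G.metric.inner (b y))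
    (G.metric.contMDiff.continuous.continuousAt.comp hb) hV hW
  simp only [FiberBundle.continuousAt_totalSpace] at h
  exact h.2

theorem isIsometric_of_dense (G : Kahler n N) (G' : Kahler d N')
    (hm : ContMDiff 𝓘(ℝ, CModel n) 𝓘(ℝ, CModel d) 1 m) {s : Set N} (hs : Dense s)
    (h : ∀ p ∈ s, ∀ v w : TangentSpace 𝓘(ℝ, CModel n) p,
      G'.metric.inner (m p) (mfderiv 𝓘(ℝ, CModel n) 𝓘(ℝ, CModel d) m p v)
        (mfderiv 𝓘(ℝ, CModel n) 𝓘(ℝ, CModel d) m p w) = G.metric.inner p v w) :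
    IsIsometric G G' m := by
  intro p v w
  let V := FiberBundle.extend (CModel n) (E := (TangentSpace 𝓘(ℝ, CModel n) : N → Type _)) v
  let W := FiberBundle.extend (CModel n) (E := (TangentSpace 𝓘(ℝ, CModel n) : N → Type _)) w
  have hV : ContinuousAt (fun q => (⟨q, V q⟩ : TangentBundle 𝓘(ℝ, CModel n) N)) p :=
    (FiberBundle.mdifferentiableAt_extend 𝓘(ℝ, CModel n) (CModel n) v).continuousAt
  have hW : ContinuousAt (fun q => (⟨q, W q⟩ : TangentBundle 𝓘(ℝ, CModel n) N)) p :=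
    (FiberBundle.mdifferentiableAt_extend 𝓘(ℝ, CModel n) (CModel n) w).continuousAt
  have hT {u : TangentBundle 𝓘(ℝ, CModel n) N} :
      ContinuousAt (tangentMap 𝓘(ℝ, CModel n) 𝓘(ℝ, CModel d) m) u :=
    (hm.continuous_tangentMap le_rfl).continuousAt
  have heq := tendsto_nhds_unique_of_frequently_eq
    (G'.continuousAt_inner hm.continuous.continuousAt (hT.comp hV) (hT.comp hW))
    (G.continuousAt_inner continuousAt_id hV hW)
    ((mem_closure_iff_frequently.1 (hs p)).mono fun q hq => h q hq (V q) (W q))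
  have hVp : V p = v := FiberBundle.extend_apply_self _ v
  have hWp : W p = w := FiberBundle.extend_apply_self _ w
  simpa only [hVp, hWp, id] using heq

end CModel

end Holomorphy

section Free

variable {n : ℕ} {N : Type*} [TopologicalSpace N] [ChartedSpace (CModel n) N]
  [IsManifold 𝓘(ℂ, CModel n) ω N] {G : Kahler n N} (Φ : TorusAction G)

theorem TorusAction.contMDiff_act (a : Torus n) :
    ContMDiff 𝓘(ℝ, CModel n) 𝓘(ℝ, CModel n) ∞ (Φ.act a) := by
  obtain ⟨t, rfl⟩ := (isOpenQuotientMap_torusMk n).surjective a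
  exact Φ.smooth.comp (contMDiff_const.prodMk contMDiff_id)

theorem TorusAction.continuous_act_left (p : N) : Continuous fun a => Φ.act a p :=
  (isOpenQuotientMap_torusMk n).isQuotientMap.continuous_iff.2
    (Φ.smooth.continuous.comp (continuous_id.prodMk continuous_const))

/-- The stabilizer of a point under a torus action. -/
def TorusAction.stabilizer (p : N) : AddSubgroup (Torus n) where
  carrier := {a | Φ.act a p = p}
  zero_mem' := Φ.act_zero p
  add_mem' {a b} ha hb := by
    rw [Set.mem_ofPred_eq] at ha hb ⊢
    rw [Φ.act_add, hb, ha]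
  neg_mem' {a} ha := by
    rw [Set.mem_ofPred_eq] at ha ⊢
    rw [← ha, ← Φ.act_add, neg_add_cancel, Φ.act_zero, ha]

theorem TorusAction.mem_free_iff {p : N} : p ∈ Φ.free ↔ Φ.stabilizer p = ⊥ :=
  (Φ.stabilizer p).eq_bot_iff_forall.symm

theorem TorusAction.dense_compl_fixed [T2Space N] [PreconnectedSpace N] {a : Torus n}
    (ha : a ≠ 0) : Dense {p | Φ.act a p = p}ᶜ := by
  rw [← interior_eq_empty_iff_dense_compl, Set.eq_empty_iff_forall_notMem]
  intro p hp
  have hol : MDifferentiable 𝓘(ℂ, CModel n) 𝓘(ℂ, CModel n) (Φ.act a) :=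
    (isHolomorphic_iff_mdifferentiable ((Φ.contMDiff_act a).mdifferentiable (by simp))).1
      (Φ.holomorphic a)
  have hid : Φ.act a = id := eq_of_mdifferentiable_of_eventuallyEq hol mdifferentiable_id
    (mem_interior_iff_mem_nhds.1 hp)
  exact ha (Φ.effective a (congrFun hid))

theorem TorusAction.dense_free [T2Space N] [PreconnectedSpace N] : Dense Φ.free := by
  have : LocallyCompactSpace N := ChartedSpace.locallyCompactSpace (CModel n) N
  -- A nontrivial stabilizer is closed, hence contains one of the countably many torsion elements.
  have hdense : Dense (⋂ a ∈ {a : Torus n | IsOfFinAddOrder a ∧ a ≠ 0}, {p | Φ.act a p = p}ᶜ) :=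
    dense_biInter_of_isOpen
      (fun a _ => (isClosed_eq (Φ.contMDiff_act a).continuous continuous_id).isOpen_compl)
      ((countable_isOfFinAddOrder_torus n).mono fun _ ha => ha.1)
      fun a ha => Φ.dense_compl_fixed ha.2
  refine hdense.mono fun p hp => Φ.mem_free_iff.2 (of_not_not fun hne => ?_)
  have hclosed : IsClosed (Φ.stabilizer p : Set (Torus n)) :=
    isClosed_eq (Φ.continuous_act_left p) continuous_const
  obtain ⟨a, ha, hne, hfin⟩ := exists_isOfFinAddOrder_mem_torus hclosed hne
  exact Set.mem_iInter₂.1 hp a ⟨hfin, hne⟩ ha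

end Free

section Lift

theorem injective_of_form_eq {V W : Type*} [AddCommGroup V] [Module ℝ V] [TopologicalSpace V]
    [AddCommGroup W] [Module ℝ W] [TopologicalSpace W] {g : V →L[ℝ] V →L[ℝ] ℝ}
    {g' : W →L[ℝ] W →L[ℝ] ℝ} {T : V →L[ℝ] W} (hpos : ∀ v, v ≠ 0 → 0 < g v v)
    (h : ∀ v, g' (T v) (T v) = g v v) : Function.Injective T := by
  refine (injective_iff_map_eq_zero T).2 fun v hv => of_not_not fun hne => (hpos v hne).ne ?_
  rw [← h, hv, map_zero]

variable {n d : ℕ}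
  {M : Type*} [TopologicalSpace M] [ChartedSpace (RModel n) M] [IsManifold (𝓡 n) ∞ M]
  {M' : Type*} [TopologicalSpace M'] [ChartedSpace (RModel d) M'] [IsManifold (𝓡 d) ∞ M']
  {N : Type*} [TopologicalSpace N] [ChartedSpace (CModel n) N] [IsManifold 𝓘(ℂ, CModel n) ω N]
  {N' : Type*} [TopologicalSpace N'] [ChartedSpace (CModel d) N']
  [IsManifold 𝓘(ℂ, CModel d) ω N']
  {S : DuallyFlat n M} {S' : DuallyFlat d M'} {G : Kahler n N} {G' : Kahler d N'}
  {Φ : TorusAction G} {Φ' : TorusAction G'} {f : M → M'} {m : N → N'}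

namespace ToricParametrization

/-- The compatible covering map `τ = F ∘ q_L` of a toric parametrization, as a map into `N`. -/
def cover (P : ToricParametrization S Φ) (u : TangentBundle (𝓡 n) M) : N :=
  P.F (quotientMap P.X u)

theorem cover_mem_free (P : ToricParametrization S Φ) (u : TangentBundle (𝓡 n) M) :
    P.cover u ∈ Φ.free :=
  (P.F _).2

theorem exists_cover_eq (P : ToricParametrization S Φ) {p : N} (hp : p ∈ Φ.free) :
    ∃ u, P.cover u = p := by
  obtain ⟨x, hx⟩ := P.F.surjective ⟨p, hp⟩
  obtain ⟨u, rfl⟩ := Quotient.exists_rep x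
  exact ⟨u, congrArg Subtype.val hx⟩

theorem mdifferentiableAt_cover (P : ToricParametrization S Φ) (u : TangentBundle (𝓡 n) M) :
    MDifferentiableAt (𝓡 n).tangent 𝓘(ℝ, CModel n) P.cover u :=
  (P.isLocalDiffeomorph u).mdifferentiableAt (by simp)

/-- The differential `τ_* : T_u(TM) → T_{τ(u)} N` of the covering map. -/
abbrev coverDeriv (P : ToricParametrization S Φ) (u : TangentBundle (𝓡 n) M) :
    TangentSpace (𝓡 n).tangent u →L[ℝ] TangentSpace 𝓘(ℝ, CModel n) (P.cover u) :=
  mfderiv (𝓡 n).tangent 𝓘(ℝ, CModel n) P.cover u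

theorem bijective_coverDeriv (P : ToricParametrization S Φ) (u : TangentBundle (𝓡 n) M) :
    Function.Bijective (P.coverDeriv u) :=
  ((P.isLocalDiffeomorph u).mfderivToContinuousLinearEquiv (by simp)).bijective

variable (P : ToricParametrization S Φ) (P' : ToricParametrization S' Φ')
  (hf : ContMDiff (𝓡 n) (𝓡 d) ∞ f) (hm : ContMDiff 𝓘(ℝ, CModel n) 𝓘(ℝ, CModel d) ∞ m)
  (hcomp : m ∘ P.cover = P'.cover ∘ tangentMap (𝓡 n) (𝓡 d) f)
include hf hm hcomp

theorem mfderiv_lift_coverDeriv (u : TangentBundle (𝓡 n) M) (A : TangentSpace (𝓡 n).tangent u) :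
    mfderiv 𝓘(ℝ, CModel n) 𝓘(ℝ, CModel d) m (P.cover u) (P.coverDeriv u A)
      = P'.coverDeriv (tangentMap (𝓡 n) (𝓡 d) f u) (secondDeriv n d f u A) := by
  have hleft := mfderiv_comp_apply u (hm.mdifferentiable (by simp) _)
    (P.mdifferentiableAt_cover u) A
  have hright := mfderiv_comp_apply u (P'.mdifferentiableAt_cover _)
    (mdifferentiable_tangentMap hf u) A
  rw [hcomp] at hleft
  exact hleft.symm.trans hright

theorem commutes_complexJ_cover_iff (u : TangentBundle (𝓡 n) M) :
    (∀ v, mfderiv 𝓘(ℝ, CModel n) 𝓘(ℝ, CModel d) m (P.cover u) (complexJ (P.cover u) v)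
      = complexJ (m (P.cover u)) (mfderiv 𝓘(ℝ, CModel n) 𝓘(ℝ, CModel d) m (P.cover u) v)) ↔
    ∀ A, secondDeriv n d f u (tangentJ S.conn u A)
      = tangentJ S'.conn (tangentMap (𝓡 n) (𝓡 d) f u) (secondDeriv n d f u A) := by
  have hchain := P.mfderiv_lift_coverDeriv P' hf hm hcomp u
  rw [(P.bijective_coverDeriv u).surjective.forall]
  refine forall_congr' fun A => ?_
  have hleft := (congrArg (mfderiv 𝓘(ℝ, CModel n) 𝓘(ℝ, CModel d) m (P.cover u))
    (P.holomorphic u A).symm).trans (hchain (tangentJ S.conn u A))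
  have hright := (congrArg (complexJ (m (P.cover u))) (hchain A)).trans
    (P'.holomorphic _ (secondDeriv n d f u A)).symm
  rw [← (P'.bijective_coverDeriv _).injective.eq_iff]
  exact ⟨fun h => hleft.symm.trans (h.trans hright), fun h => hleft.trans (h.trans hright.symm)⟩

theorem inner_mfderiv_lift_coverDeriv (u : TangentBundle (𝓡 n) M)
    (A B : TangentSpace (𝓡 n).tangent u) :
    G'.metric.inner (m (P.cover u))
        (mfderiv 𝓘(ℝ, CModel n) 𝓘(ℝ, CModel d) m (P.cover u) (P.coverDeriv u A))
        (mfderiv 𝓘(ℝ, CModel n) 𝓘(ℝ, CModel d) m (P.cover u) (P.coverDeriv u B))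
      = tangentMetric S' (tangentMap (𝓡 n) (𝓡 d) f u)
        (secondDeriv n d f u A) (secondDeriv n d f u B) := by
  have hpoint : m (P.cover u) = P'.cover (tangentMap (𝓡 n) (𝓡 d) f u) := congrFun hcomp u
  rw [P.mfderiv_lift_coverDeriv P' hf hm hcomp, P.mfderiv_lift_coverDeriv P' hf hm hcomp, hpoint]
  exact P'.isometric _ _ _

theorem inner_cover_iff (u : TangentBundle (𝓡 n) M) :
    (∀ v w, G'.metric.inner (m (P.cover u))
        (mfderiv 𝓘(ℝ, CModel n) 𝓘(ℝ, CModel d) m (P.cover u) v)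
        (mfderiv 𝓘(ℝ, CModel n) 𝓘(ℝ, CModel d) m (P.cover u) w)
      = G.metric.inner (P.cover u) v w) ↔
    ∀ A B, tangentMetric S' (tangentMap (𝓡 n) (𝓡 d) f u)
      (secondDeriv n d f u A) (secondDeriv n d f u B) = tangentMetric S u A B := by
  have hsurj := (P.bijective_coverDeriv u).surjective
  rw [hsurj.forall₂]
  refine forall₂_congr fun A B => ?_
  rw [P.inner_mfderiv_lift_coverDeriv P' hf hm hcomp, ← P.isometric u A B]
  rfl

variable [T2Space N] [PreconnectedSpace N]

theorem isHolomorphic_iff_commutesWithConnectors :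
    IsHolomorphic n d m ↔ CommutesWithConnectors S.conn S'.conn f := by
  rw [commutesWithConnectors_iff_tangentJ hf]
  refine ⟨fun h u => (P.commutes_complexJ_cover_iff P' hf hm hcomp u).1 (h _), fun h => ?_⟩
  refine isHolomorphic_of_dense (hm.of_le (by simp)) Φ.dense_free fun p hp => ?_
  obtain ⟨u, rfl⟩ := P.exists_cover_eq hp
  exact (P.commutes_complexJ_cover_iff P' hf hm hcomp u).2 (h u)

theorem isIsometric_iff_tangentMetric :
    IsIsometric G G' m ↔ ∀ u A B, tangentMetric S' (tangentMap (𝓡 n) (𝓡 d) f u)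
      (secondDeriv n d f u A) (secondDeriv n d f u B) = tangentMetric S u A B := by
  refine ⟨fun h u => (P.inner_cover_iff P' hf hm hcomp u).1 (h _), fun h => ?_⟩
  refine isIsometric_of_dense G G' (hm.of_le (by simp)) Φ.dense_free fun p hp => ?_
  obtain ⟨u, rfl⟩ := P.exists_cover_eq hp
  exact (P.inner_cover_iff P' hf hm hcomp u).2 (h u)

variable [ConnectedSpace M]

theorem isKahlerImmersion_iff_isIsometricAffineImmersion :
    IsKahlerImmersion G G' m ↔ IsIsometricAffineImmersion S S' f := by
  have hX := P.isGenerator.isParallelFrame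
  have hX' := P'.isGenerator.isParallelFrame
  have hhol : IsHolomorphic n d m ↔ IsAffineMap S.conn S'.conn f := by
    rw [P.isHolomorphic_iff_commutesWithConnectors P' hf hm hcomp,
      commutesWithConnectors_iff_exists_hasFrameMatrix hX hX' hf,
      isAffineMap_iff_exists_hasFrameMatrix hX hX' S.flat.torsion_eq_zero
        S'.flat.torsion_eq_zero hf]
  have hiso (h : IsHolomorphic n d m) := (P.isIsometric_iff_tangentMetric P' hf hm hcomp).trans
    (((P.isHolomorphic_iff_commutesWithConnectors P' hf hm hcomp).1 h).tangentMetric_iff hf)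
  constructor
  · intro h
    have hinner := (hiso h.holomorphic).1 h.isometric
    exact ⟨hf, fun p => injective_of_form_eq (S.metric.pos p) fun v => hinner p v v, hinner,
      hhol.1 h.holomorphic⟩
  · intro h
    have hinner := (hiso (hhol.2 h.affine)).2 h.isometric
    exact ⟨hm, fun p => injective_of_form_eq (G.metric.pos p) fun v => hinner p v v,
      hhol.2 h.affine, hinner⟩

end ToricParametrization

end Lift

section Equivariance

open scoped Matrix

theorem exists_intMatrix_mulVec {n d : ℕ} (b : (Fin n → ℝ) →ₗ[ℝ] (Fin d → ℝ))
    (hb : ∀ i j, ∃ k : ℤ, (k : ℝ) = b (Pi.single i 1) j) :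
    ∃ a : Matrix (Fin d) (Fin n) ℤ, ∀ t, b t = a.map (Int.cast : ℤ → ℝ) *ᵥ t := by
  choose k hk using hb
  refine ⟨Matrix.of fun j i => k i j, fun t => ?_⟩
  rw [← LinearMap.toMatrix'_mulVec]
  congr 1
  ext j i
  rw [LinearMap.toMatrix'_apply, Matrix.map_apply, Matrix.of_apply, hk]

theorem torusMk_eq_zero_iff {n : ℕ} {t : Fin n → ℝ} :
    Torus.mk t = 0 ↔ ∀ i, ∃ k : ℤ, (k : ℝ) = t i := by
  simp only [funext_iff, Torus.mk, Pi.zero_apply, AddCircle.coe_eq_zero_iff, zsmul_eq_mul, mul_one]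

variable {n d : ℕ}
  {M : Type*} [TopologicalSpace M] [ChartedSpace (RModel n) M]
  {M' : Type*} [TopologicalSpace M'] [ChartedSpace (RModel d) M']
  {X : Fin n → Π p : M, TangentSpace (𝓡 n) p} {X' : Fin d → Π p : M', TangentSpace (𝓡 d) p}
  {f : M → M'} {a : RModel n →L[ℝ] RModel d}

variable [IsManifold (𝓡 n) ∞ M] [IsManifold (𝓡 d) ∞ M']

theorem HasFrameMatrix.mfderiv_frameMap (ha : HasFrameMatrix X X' f a) (hX : IsFrame X)
    (hX' : IsFrame X') (p : M) (c : RModel n) :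
    mfderiv (𝓡 n) (𝓡 d) f p (frameMap X p c) = frameMap X' (f p) (a c) := by
  apply hX'.coframe_injective
  rw [hX'.coframe_frameMap]
  exact (ha ⟨p, frameMap X p c⟩).trans (congrArg a (hX.coframe_frameMap p c))

theorem HasFrameMatrix.tangentMap_translate (ha : HasFrameMatrix X X' f a) (hX : IsFrame X)
    (hX' : IsFrame X') (t : Fin n → ℝ) (u : TangentBundle (𝓡 n) M) :
    tangentMap (𝓡 n) (𝓡 d) f (translate X t u)
      = translate X' (a (WithLp.toLp 2 t)).ofLp (tangentMap (𝓡 n) (𝓡 d) f u) := by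
  have hframe := ha.mfderiv_frameMap hX hX' u.proj (WithLp.toLp 2 t)
  rw [frameMap_apply, frameMap_apply] at hframe
  refine congrArg (Bundle.TotalSpace.mk (f u.proj)) ?_
  exact (map_add (mfderiv (𝓡 n) (𝓡 d) f u.proj) u.2 _).trans
    (congrArg (fun v => mfderiv (𝓡 n) (𝓡 d) f u.proj u.2 + v) hframe)

theorem HasFrameMatrix.injective (ha : HasFrameMatrix X X' f a) (hX : IsFrame X)
    (hX' : IsFrame X') {p : M} (hp : Function.Injective (mfderiv (𝓡 n) (𝓡 d) f p)) :
    Function.Injective a := by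
  have hcomp : frameMap X' (f p) ∘ a = mfderiv (𝓡 n) (𝓡 d) f p ∘ frameMap X p :=
    funext fun c => (ha.mfderiv_frameMap hX hX' p c).symm
  refine Function.Injective.of_comp (f := frameMap X' (f p)) ?_
  rw [hcomp]
  exact hp.comp (hX.isInvertible p).injective

variable {N : Type*} [TopologicalSpace N] [ChartedSpace (CModel n) N]
  [IsManifold 𝓘(ℂ, CModel n) ω N]
  {N' : Type*} [TopologicalSpace N'] [ChartedSpace (CModel d) N']
  [IsManifold 𝓘(ℂ, CModel d) ω N']
  {S : DuallyFlat n M} {S' : DuallyFlat d M'} {G : Kahler n N} {G' : Kahler d N'}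
  {Φ : TorusAction G} {Φ' : TorusAction G'} {m : N → N'}

theorem TorusAction.eq_of_act_eq {p : N} (hp : p ∈ Φ.free) {b c : Torus n}
    (h : Φ.act b p = Φ.act c p) : b = c := by
  refine (neg_add_eq_zero.1 (hp _ ?_)).symm
  rw [Φ.act_add, h, ← Φ.act_add, neg_add_cancel, Φ.act_zero]

namespace ToricParametrization

variable (P : ToricParametrization S Φ) (P' : ToricParametrization S' Φ')
  (hcomp : m ∘ P.cover = P'.cover ∘ tangentMap (𝓡 n) (𝓡 d) f)
include hcomp

theorem lift_cover_mem_free (u : TangentBundle (𝓡 n) M) : m (P.cover u) ∈ Φ'.free := by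
  rw [show m (P.cover u) = P'.cover _ from congrFun hcomp u]
  exact P'.cover_mem_free _

theorem lift_act_cover (ha : HasFrameMatrix P.X P'.X f a) (t : Fin n → ℝ)
    (u : TangentBundle (𝓡 n) M) :
    m (Φ.act (Torus.mk t) (P.cover u))
      = Φ'.act (Torus.mk (a (WithLp.toLp 2 t)).ofLp) (m (P.cover u)) := by
  have hlift (v : TangentBundle (𝓡 n) M) : m (P.cover v) = P'.cover (tangentMap (𝓡 n) (𝓡 d) f v) :=
    congrFun hcomp v
  calc m (Φ.act (Torus.mk t) (P.cover u))
      = m (P.cover (translate P.X t u)) := congrArg m (P.equivariant t u).symm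
    _ = P'.cover (translate P'.X (a (WithLp.toLp 2 t)).ofLp (tangentMap (𝓡 n) (𝓡 d) f u)) := by
      rw [hlift, ha.tangentMap_translate P.isGenerator.isParallelFrame.toIsFrame
        P'.isGenerator.isParallelFrame.toIsFrame]
    _ = Φ'.act (Torus.mk (a (WithLp.toLp 2 t)).ofLp) (m (P.cover u)) := by
      rw [hlift]
      exact P'.equivariant _ _

theorem exists_intMatrix [Nonempty M] (ha : HasFrameMatrix P.X P'.X f a) :
    ∃ A : Matrix (Fin d) (Fin n) ℤ, ∀ t : Fin n → ℝ,
      (a (WithLp.toLp 2 t)).ofLp = A.map (Int.cast : ℤ → ℝ) *ᵥ t := by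
  obtain ⟨p⟩ := ‹Nonempty M›
  let u : TangentBundle (𝓡 n) M := ⟨p, 0⟩
  refine exists_intMatrix_mulVec ((WithLp.linearEquiv 2 ℝ (Fin d → ℝ)).toLinearMap ∘ₗ
    a.toLinearMap ∘ₗ (WithLp.linearEquiv 2 ℝ (Fin n → ℝ)).symm.toLinearMap) fun i => ?_
  have hsingle : Torus.mk (Pi.single i 1 : Fin n → ℝ) = 0 :=
    torusMk_eq_zero_iff.2 fun j => ⟨(Pi.single i 1 : Fin n → ℤ) j, by
      rw [Pi.single_apply, Pi.single_apply]; push_cast; rfl⟩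
  -- `[eᵢ] = 0` fixes `τ(u)`, so its image `[a eᵢ]` fixes the free point `m (τ(u))`.
  have hfix := P.lift_act_cover P' hcomp ha (Pi.single i 1) u
  rw [hsingle, Φ.act_zero] at hfix
  exact torusMk_eq_zero_iff.1 (P.lift_cover_mem_free P' hcomp u _ hfix.symm)

theorem lift_act [T2Space N] [PreconnectedSpace N] [T2Space N'] (hm : Continuous m)
    (ha : HasFrameMatrix P.X P'.X f a) {A : Matrix (Fin d) (Fin n) ℤ}
    (hA : ∀ t : Fin n → ℝ, (a (WithLp.toLp 2 t)).ofLp = A.map (Int.cast : ℤ → ℝ) *ᵥ t)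
    (b : Torus n) (p : N) : m (Φ.act b p) = Φ'.act (torusHom A b) (m p) := by
  refine congrFun (Continuous.ext_on Φ.dense_free (hm.comp (Φ.contMDiff_act b).continuous)
    ((Φ'.contMDiff_act _).continuous.comp hm) fun q hq => ?_) p
  obtain ⟨u, rfl⟩ := P.exists_cover_eq hq
  obtain ⟨t, rfl⟩ := (isOpenQuotientMap_torusMk n).surjective b
  rw [Function.comp_apply, Function.comp_apply, torusHom_mk, ← hA]
  exact P.lift_act_cover P' hcomp ha t u

theorem exists_equivariant_isLieHom [ConnectedSpace M] [T2Space N] [PreconnectedSpace N]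
    [T2Space N'] (hm : Continuous m) (hf : IsIsometricAffineImmersion S S' f) :
    ∃ ρ : Torus n →+ Torus d, IsLieHom ρ ∧ (ρ.ker : Set (Torus n)).Finite ∧
      ∀ b p, m (Φ.act b p) = Φ'.act (ρ b) (m p) := by
  have hX := P.isGenerator.isParallelFrame
  have hX' := P'.isGenerator.isParallelFrame
  obtain ⟨a, ha⟩ := (isAffineMap_iff_exists_hasFrameMatrix hX hX' S.flat.torsion_eq_zero
    S'.flat.torsion_eq_zero hf.smooth).1 hf.affine
  obtain ⟨A, hA⟩ := P.exists_intMatrix P' hcomp ha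
  obtain ⟨p⟩ : Nonempty M := inferInstance
  have hinj : Function.Injective (A.map (Int.cast : ℤ → ℝ)).mulVec := by
    have heq : (A.map (Int.cast : ℤ → ℝ)).mulVec = WithLp.ofLp ∘ a ∘ WithLp.toLp 2 :=
      funext fun t => (hA t).symm
    rw [heq]
    exact (WithLp.ofLp_injective 2).comp
      ((ha.injective hX.toIsFrame hX'.toIsFrame (hf.immersion p)).comp (WithLp.toLp_injective 2))
  exact ⟨torusHom A, isLieHom_torusHom A, finite_ker_torusHom hinj, P.lift_act P' hcomp hm ha hA⟩

theorem equivariant_hom_unique [Nonempty M] {ρ ρ' : Torus n →+ Torus d}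
    (hρ : ∀ b p, m (Φ.act b p) = Φ'.act (ρ b) (m p))
    (hρ' : ∀ b p, m (Φ.act b p) = Φ'.act (ρ' b) (m p)) : ρ = ρ' := by
  obtain ⟨p⟩ := ‹Nonempty M›
  exact AddMonoidHom.ext fun b => TorusAction.eq_of_act_eq
    (P.lift_cover_mem_free P' hcomp ⟨p, 0⟩) ((hρ b _).symm.trans (hρ' b _))

end ToricParametrization

theorem IsLift.exists_cover_comp (h : IsLift S Φ S' Φ' f m) :
    ∃ (P : ToricParametrization S Φ) (P' : ToricParametrization S' Φ'),
      m ∘ P.cover = P'.cover ∘ tangentMap (𝓡 n) (𝓡 d) f := by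
  obtain ⟨τ, τ', ⟨P, hP⟩, ⟨P', hP'⟩, hτ⟩ := h.exists_covering
  refine ⟨P, P', funext fun u => ?_⟩
  have hu := hτ u
  rwa [hP, hP'] at hu

end Equivariance

end Torif

end

open Torif in
theorem proposition9p3_general {n d : ℕ}
    {M : Type*} [TopologicalSpace M] [ConnectedSpace M] [ChartedSpace (RModel n) M]
    [IsManifold (𝓡 n) ∞ M]
    {M' : Type*} [TopologicalSpace M'] [ChartedSpace (RModel d) M'] [IsManifold (𝓡 d) ∞ M']
    {N : Type*} [TopologicalSpace N] [T2Space N] [PreconnectedSpace N]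
    [ChartedSpace (CModel n) N] [IsManifold 𝓘(ℂ, CModel n) ω N]
    {N' : Type*} [TopologicalSpace N'] [T2Space N']
    [ChartedSpace (CModel d) N'] [IsManifold 𝓘(ℂ, CModel d) ω N']
    {S : DuallyFlat n M} {S' : DuallyFlat d M'} {G : Kahler n N} {G' : Kahler d N'}
    {Φ : TorusAction G} {Φ' : TorusAction G'} {f : M → M'} {m : N → N'}
    (hlift : IsLift S Φ S' Φ' f m) :
    (IsKahlerImmersion G G' m ↔ IsIsometricAffineImmersion S S' f) ∧
    (IsIsometricAffineImmersion S S' f →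
      ∃ ρ : Torus n →+ Torus d, IsLieHom ρ ∧ (ρ.ker : Set (Torus n)).Finite ∧
        (∀ a p, m (Φ.act a p) = Φ'.act (ρ a) (m p)) ∧
        ∀ ρ' : Torus n →+ Torus d,
          (∀ a p, m (Φ.act a p) = Φ'.act (ρ' a) (m p)) → ρ' = ρ) := by
  obtain ⟨P, P', hcomp⟩ := hlift.exists_cover_comp
  refine ⟨P.isKahlerImmersion_iff_isIsometricAffineImmersion P' hlift.smooth_base hlift.smooth
    hcomp, fun hf => ?_⟩
  obtain ⟨ρ, hlie, hker, hequiv⟩ :=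
    P.exists_equivariant_isLieHom P' hcomp hlift.smooth.continuous hf
  exact ⟨ρ, hlie, hker, hequiv, fun ρ' hρ' => P.equivariant_hom_unique P' hcomp hρ' hequiv⟩

open Torif in
theorem proposition9p3 {n d : ℕ}
    {M : Type*} [TopologicalSpace M] [T2Space M] [SecondCountableTopology M] [ConnectedSpace M]
    [ChartedSpace (RModel n) M] [IsManifold (𝓡 n) ∞ M]
    {M' : Type*} [TopologicalSpace M'] [T2Space M'] [SecondCountableTopology M']
    [ConnectedSpace M'] [ChartedSpace (RModel d) M'] [IsManifold (𝓡 d) ∞ M']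
    {N : Type*} [TopologicalSpace N] [T2Space N] [SecondCountableTopology N] [ConnectedSpace N]
    [ChartedSpace (CModel n) N] [IsManifold 𝓘(ℂ, CModel n) ω N]
    {N' : Type*} [TopologicalSpace N'] [T2Space N'] [SecondCountableTopology N']
    [ConnectedSpace N'] [ChartedSpace (CModel d) N'] [IsManifold 𝓘(ℂ, CModel d) ω N']
    (S : DuallyFlat n M) (S' : DuallyFlat d M') (G : Kahler n N) (G' : Kahler d N')
    (Φ : TorusAction G) (Φ' : TorusAction G')
    (hΦ : IsTorification S Φ) (hΦ' : IsTorification S' Φ')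
    (f : M → M') (m : N → N') (hlift : IsLift S Φ S' Φ' f m) :
    (IsKahlerImmersion G G' m ↔ IsIsometricAffineImmersion S S' f) ∧
    (IsIsometricAffineImmersion S S' f →
      ∃ ρ : Torus n →+ Torus d, IsLieHom ρ ∧ (ρ.ker : Set (Torus n)).Finite ∧
        (∀ a p, m (Φ.act a p) = Φ'.act (ρ a) (m p)) ∧
        ∀ ρ' : Torus n →+ Torus d, IsLieHom ρ' →
          (∀ a p, m (Φ.act a p) = Φ'.act (ρ' a) (m p)) → ρ' = ρ) := by
  obtain ⟨hiff, hhom⟩ := proposition9p3_general hlift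
  exact ⟨hiff, fun hf => (hhom hf).imp fun _ ⟨hlie, hker, hequiv, huniq⟩ =>
    ⟨hlie, hker, hequiv, fun ρ' _ => huniq ρ'⟩⟩
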